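/- **Theorem (exponential decay for Vlasov fields supported on $\mathcal D_\alpha$, hyperbolic plane).** Let $\mathbb H^2=\{(\cosh r,\sinh r\cos\theta,\sinh r\sin\theta): r\ge 0,\ \theta\in\mathbb R\}\subset\mathbb R^{1+2}$ be the upper branch of the hyperboloid, with the Riemannian metric $g=dr^2+\sinh^2 r\,d\theta^2$ induced by the Minkowski metric $-dt^2+(dx^1)^2+(dx^2)^2$. In local coordinates, let $X=v^i\partial_{x^i}-v^iv^j\Gamma^k_{ij}\partial_{v^k}$ be the generator of the geodesic flow on $T\mathbb H^2$. A Vlasov field is a $C^1$ function $f:[0,\infty)\times T\mathbb H^2\to\mathbb R$ with $\partial_t f+Xf=0$, and its spatial density is $\rho(f)(t,x)=\int_{T_x\mathbb H^2} f(t,x,v)\,d\mathrm{vol}_{T_x\mathbb H^2}(v)$. For $f_0\in C^1$ with compact support on $T\mathbb H^2$, let $\|f_0\|_{L^\infty}=\sup|f_0|$ and $\|f_0\|_{W^{1,\infty}}=\sup|f_0|+\sup|df_0|$, where $|df_0|$ is the norm of the differential with respect to the Sasaki metric of $T\mathbb H^2$, i.e. the metric with $|\mathrm{Hor}(a)+\mathrm{Ver}(b)|^2=g(a,a)+g(b,b)$,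 where $\mathrm{Hor}(a)=a^i\partial_{x^i}-a^iv^j\Gamma_{ij}^k\partial_{v^k}$ and $\mathrm{Ver}(b)=b^i\partial_{v^i}$. Let $\alpha>0$, let $\mathcal D_\alpha=\{(x,v)\in T\mathbb H^2: g_x(v,v)\ge\alpha^2\}$, and let $K\subset\mathcal D_\alpha$ be compact. There is a constant $C>0$, depending only on $\alpha$ and $K$, such that the following holds for every $f_0\in C^1(T\mathbb H^2)$ that vanishes outside $K$. There is a Vlasov field $f$ with $f(0,\cdot)=f_0$; and for every such $f$ and every $t\ge 0$, the integral defining $\rho(f)(t,x)$ converges absolutely for every $x$, the function $\rho(f)(t,\cdot)$ is $C^1$ on $\mathbb H^2$, and $$|\rho(f)(t,x)|\le C e^{-\alpha t}\|f_0\|_{L^\infty}\qquad\text{for every }x\in\mathbb H^2,$$ $$\Big|\frac1{\sinh r}\partial_\theta\rho(f)(t,x)\Big|\le C e^{-2\alpha t}\|f_0\|_{W^{1,\infty}},\qquad |\partial_r\rho(f)(t,x)|\le C e^{-\alpha t}\|f_0\|_{W^{1,\infty}}$$ for every $x\in\mathbb H^2$ with polar coordinates $(r,\theta)$, $r>0$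 (the frame $\{\partial_r,(\sinh r)^{-1}\partial_\theta\}$ is not defined at $r=0$). -/

import Mathlib

open MeasureTheory

noncomputable section

namespace HypVlasov

/-- The Minkowski form `-dt ⊗ dt + dx¹ ⊗ dx¹ + dx² ⊗ dx²` on `ℝ³`. -/
def minkowski (u w : Fin 3 → ℝ) : ℝ := -(u 0 * w 0) + u 1 * w 1 + u 2 * w 2

/-- The upper branch of the hyperboloid, `ℍ² ⊂ ℝ³`. -/
def hyperboloid : Set (Fin 3 → ℝ) := {u | minkowski u u = -1 ∧ 0 < u 0}

/-- Coordinates on `ℍ²`, and components of tangent vectors in these coordinates. -/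
abbrev Coord := Fin 2 → ℝ

/-- The tangent bundle `Tℍ²` in the global chart: pairs `(y, v)` of a point and the components
of a tangent vector. As the chart is a global diffeomorphism, being of class `C¹`, being compact
and so on mean the same on `Tℍ²` and in these coordinates. -/
abbrev TH2 := Coord × Coord

/-- The global smooth parametrization of the hyperboloid as a graph,
`y ↦ (√(1 + |y|²), y)`. -/
def param (y : Coord) : Fin 3 → ℝ := ![Real.sqrt (1 + y 0 ^ 2 + y 1 ^ 2), y 0, y 1]

theorem param_injective : Function.Injective param := by
  intro y z h
  have h1 := congrFun h 1
  have h2 := congrFun h 2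
  simp only [param, Matrix.cons_val] at h1 h2
  ext i
  fin_cases i
  · exact h1
  · exact h2

theorem range_param : Set.range param = hyperboloid := by
  ext u
  constructor
  · rintro ⟨y, rfl⟩
    have h : 0 < 1 + y 0 ^ 2 + y 1 ^ 2 := by positivity
    refine ⟨?_, ?_⟩
    · simp only [minkowski, param, Matrix.cons_val]
      rw [Real.mul_self_sqrt h.le]
      ring
    · simpa [param] using h
  · rintro ⟨h1, h2⟩
    refine ⟨![u 1, u 2], ?_⟩
    have h3 : 1 + u 1 ^ 2 + u 2 ^ 2 = u 0 ^ 2 := by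
      unfold minkowski at h1
      linarith
    ext i
    fin_cases i
    · simp [param, h3, Real.sqrt_sq h2.le]
    · simp [param]
    · simp [param]

/-- Polar coordinates `(r, θ)` on `ℍ²`, expressed in the global chart. -/
def polar (r θ : ℝ) : Coord := ![Real.sinh r * Real.cos θ, Real.sinh r * Real.sin θ]

theorem param_polar (r θ : ℝ) :
    param (polar r θ) = ![Real.cosh r, Real.sinh r * Real.cos θ, Real.sinh r * Real.sin θ] := by
  have h : 1 + (Real.sinh r * Real.cos θ) ^ 2 + (Real.sinh r * Real.sin θ) ^ 2
      = Real.cosh r ^ 2 := by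
    rw [Real.cosh_sq]
    linear_combination Real.sinh r ^ 2 * Real.sin_sq_add_cos_sq θ
  simp [param, polar, h, Real.sqrt_sq (Real.cosh_pos r).le]

/-- The Riemannian metric of `ℍ²` induced by the Minkowski form: `g_y(a, b)`. -/
def metric (y a b : Coord) : ℝ := minkowski (fderiv ℝ param y a) (fderiv ℝ param y b)

/-- The matrix `(g_{ij}(y))` of the metric in the global chart. -/
def gram (y : Coord) : Matrix (Fin 2) (Fin 2) ℝ :=
  Matrix.of fun i j => metric y (Pi.single i 1) (Pi.single j 1)

/-- The coordinate derivative `∂_{y^i} φ (y)`. -/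
def coordDeriv (i : Fin 2) (φ : Coord → ℝ) (y : Coord) : ℝ := fderiv ℝ φ y (Pi.single i 1)

/-- The Christoffel symbol `Γ^k_{ij} = ½ g^{kl} (∂_i g_{jl} + ∂_j g_{il} - ∂_l g_{ij})`. -/
def christoffel (k i j : Fin 2) (y : Coord) : ℝ :=
  (1 / 2) * ∑ l, (gram y)⁻¹ k l *
    (coordDeriv i (fun z => gram z j l) y + coordDeriv j (fun z => gram z i l) y
      - coordDeriv l (fun z => gram z i j) y)

/-- The horizontal lift `Hor_{(y,v)}(a) = a^i ∂_{y^i} - a^i v^j Γ^k_{ij} ∂_{v^k}`. -/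
def hor (y v a : Coord) : TH2 := (a, fun k => -∑ i, ∑ j, a i * v j * christoffel k i j y)

/-- The vertical lift `Ver(b) = b^i ∂_{v^i}`. -/
def ver (b : Coord) : TH2 := (0, b)

/-- `f : [0,∞) × Tℍ² → ℝ` is a (classical, `C¹`) Vlasov field: `∂_t f + X f = 0`, where
`X = Hor_{(y,v)}(v)` is the generator of the geodesic flow. Values at negative times
play no role. -/
structure IsVlasovField (f : ℝ → TH2 → ℝ) : Prop where
  contDiffOn : ContDiffOn ℝ 1 (fun q : ℝ × TH2 => f q.1 q.2) (Set.Ici 0 ×ˢ Set.univ)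
  vlasov : ∀ t : ℝ, 0 ≤ t → ∀ y v : Coord,
    derivWithin (fun s => f s (y, v)) (Set.Ici 0) t + fderiv ℝ (f t) (y, v) (hor y v v) = 0

/-- The spatial density `ρ(f)(t, y) = ∫ f(t, y, v) dvol_{T_y ℍ²}(v)`, where
`dvol_{T_y ℍ²} = √(det g) dv¹ dv²`. -/
def spatialDensity (f : ℝ → TH2 → ℝ) (t : ℝ) (y : Coord) : ℝ :=
  ∫ v : Coord, f t (y, v) * Real.sqrt (gram y).det

/-- The set `𝓓_α = {(x, v) : g_x(v, v) ≥ α²}`. -/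
def energySet (α : ℝ) : Set TH2 := {p | α ^ 2 ≤ metric p.1 p.2 p.2}

/-- The sup norm `‖F‖_{L^∞}`, for continuous compactly supported `F`. -/
def supNorm (F : TH2 → ℝ) : ℝ := ⨆ p, |F p|

/-- The sup over `Tℍ²` of the norm of the differential `dF` with respect to the Sasaki metric, for
which `Hor(a) + Ver(b)` has squared length `g(a, a) + g(b, b)`; for compactly supported `C¹`
functions `F`. -/
def sasakiGradSup (F : TH2 → ℝ) : ℝ :=
  sSup {s | ∃ y v a b : Coord, metric y a a + metric y b b ≤ 1 ∧
    s = |fderiv ℝ F (y, v) (hor y v a + ver b)|}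

/-- The norm `‖F‖_{W^{1,∞}}`, for compactly supported `C¹` functions `F`. -/
def sobolevNorm (F : TH2 → ℝ) : ℝ := supNorm F + sasakiGradSup F

end HypVlasov

end

namespace HypVlasov

/-! In Minkowski space the geodesics of ℍ² are explicit: a point x with velocity v and E = g(v,v)
moves to cosh(√E t) x + (sinh(√E t)/√E) v. A Vlasov field is constant along this flow
(`IsVlasovField.eq_transport`), so it is the initial datum pulled back by time -t. Write H = `height
y` = cosh r; the volume density of the fibre over y is 1/H.

Decay: suppose (y, v) arrives from K at time t, and split v in the chart into components along and
across y. The first is at most βH, where β bounds the speeds on K. The second is O(e^{-αt}): running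
the geodesic backwards multiplies it by sinh(√E t)/√E, and the starting point lies in a fixed ball
(`abs_le_of_mem_shell`). These v fill an area O(H e^{-αt}), and the factor 1/H cancels H.

Derivatives: boosts are isometries commuting with the flow, so moving y by a boost amounts to
precomposing the datum with it (`density_boostPoint`). The difference of the datum and its boost is
controlled by the Sasaki gradient, and the decay estimate for this difference gives |dρ(H n)| =
O(e^{-αt}) for every Euclidean unit vector n (`abs_fderiv_density_smul_le`). Now ∂_r is H (cos θ,
sin θ), while the unit angular vector is (-sin θ, cos θ), without H. So the angular derivative gains
1/H, and as ρ vanishes unless H is at least of order e^{αt} (`exp_le_height_of_mem_shell`), this is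
the second exponential. -/

/-! ### Metric, Christoffel symbols and horizontal lifts in the graph chart. -/

/-- The time component of the point of the hyperboloid with coordinates `y`. -/
noncomputable def height (y : Coord) : ℝ := Real.sqrt (1 + y 0 ^ 2 + y 1 ^ 2)

/-- The time component of the tangent vector with components `v` at `y`. -/
noncomputable def vheight (y v : Coord) : ℝ := (y 0 * v 0 + y 1 * v 1) / height y

theorem height_sq (y : Coord) : height y ^ 2 = 1 + y 0 ^ 2 + y 1 ^ 2 :=
  Real.sq_sqrt (by positivity)

theorem height_pos (y : Coord) : 0 < height y := Real.sqrt_pos.2 (by positivity)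

theorem one_le_height (y : Coord) : 1 ≤ height y := by
  nlinarith [height_sq y, height_pos y, sq_nonneg (y 0), sq_nonneg (y 1)]

theorem height_mul_vheight (y v : Coord) : height y * vheight y v = y 0 * v 0 + y 1 * v 1 := by
  have := (height_pos y).ne'
  unfold vheight
  field_simp

/-- The coordinate functional `y ↦ y i`. -/
def coordCLM (i : Fin 2) : Coord →L[ℝ] ℝ := ContinuousLinearMap.proj i

@[simp] theorem coordCLM_apply (i : Fin 2) (y : Coord) : coordCLM i y = y i := rfl

theorem hasFDerivAt_coord (i : Fin 2) (y : Coord) :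
    HasFDerivAt (fun z : Coord => z i) (coordCLM i) y := hasFDerivAt_apply i y

theorem hasFDerivAt_height (y : Coord) :
    HasFDerivAt height ((height y)⁻¹ • (y 0 • coordCLM 0 + y 1 • coordCLM 1)) y := by
  have h := ((((hasFDerivAt_coord 0 y).pow 2).const_add 1).add ((hasFDerivAt_coord 1 y).pow 2)).sqrt
    (show 1 + y 0 ^ 2 + y 1 ^ 2 ≠ 0 by positivity)
  refine h.congr_fderiv ?_
  ext a
  have := (height_pos y).ne'
  simp [height] at this ⊢
  field_simp

theorem contDiff_height {n : WithTop ℕ∞} : ContDiff ℝ n height := by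
  unfold height
  refine ContDiff.sqrt (by fun_prop) fun y => ?_
  positivity

theorem fderiv_param (y a : Coord) : fderiv ℝ param y a = ![vheight y a, a 0, a 1] := by
  have h : HasFDerivAt param (ContinuousLinearMap.pi
      ![(height y)⁻¹ • (y 0 • coordCLM 0 + y 1 • coordCLM 1), coordCLM 0, coordCLM 1]) y := by
    rw [hasFDerivAt_pi]
    intro i
    fin_cases i
    · exact hasFDerivAt_height y
    · exact hasFDerivAt_apply 0 y
    · exact hasFDerivAt_apply 1 y
  rw [h.fderiv]
  ext i
  fin_cases i
  · simp [vheight]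
    ring
  · simp
  · simp

theorem metric_eq (y a b : Coord) :
    metric y a b = a 0 * b 0 + a 1 * b 1 - vheight y a * vheight y b := by
  simp only [metric, minkowski, fderiv_param, Matrix.cons_val]
  ring

theorem metric_self_eq (y v : Coord) :
    metric y v v = v 0 ^ 2 + v 1 ^ 2 - vheight y v ^ 2 := by
  rw [metric_eq]
  ring

theorem gram_apply (y : Coord) (i j : Fin 2) :
    gram y i j = (if i = j then 1 else 0) - y i * y j * (height y ^ 2)⁻¹ := by
  have := (height_pos y).ne'
  fin_cases i <;> fin_cases j <;> simp [gram, metric_eq, vheight] <;> field_simp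

theorem det_gram (y : Coord) : (gram y).det = (height y ^ 2)⁻¹ := by
  have := (height_pos y).ne'
  have h := height_sq y
  rw [Matrix.det_fin_two]
  simp only [gram_apply]
  simp
  field_simp
  linear_combination height y ^ 2 * h

theorem sqrt_det_gram (y : Coord) : Real.sqrt (gram y).det = (height y)⁻¹ := by
  rw [det_gram, Real.sqrt_inv, Real.sqrt_sq (height_pos y).le]

theorem inv_gram (y : Coord) : (gram y)⁻¹ = Matrix.of fun i j => (if i = j then 1 else 0) + y i * y j := by
  have := (height_pos y).ne'
  have h := height_sq y
  refine Matrix.inv_eq_right_inv ?_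
  ext i j
  rw [Matrix.mul_apply, Fin.sum_univ_two]
  simp only [gram_apply, Matrix.of_apply]
  fin_cases i <;> fin_cases j <;> simp <;> field_simp
  · linear_combination (y 0 ^ 2) * h
  · linear_combination (y 0 * y 1) * h
  · linear_combination (y 0 * y 1) * h
  · linear_combination (y 1 ^ 2) * h

theorem coordDeriv_gram (y : Coord) (i j l : Fin 2) :
    coordDeriv i (fun z => gram z j l) y =
      -(((if i = j then y l else 0) + (if i = l then y j else 0)) * (height y ^ 2)⁻¹)
        + 2 * y i * y j * y l * (height y ^ 2)⁻¹ ^ 2 := by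
  have hH := (height_pos y).ne'
  have h2 : HasFDerivAt (fun z => (height z ^ 2)⁻¹) _ y :=
    HasDerivAt.comp_hasFDerivAt y (hasDerivAt_inv (pow_ne_zero 2 hH))
      ((hasFDerivAt_height y).pow 2)
  have h := (((hasFDerivAt_coord j y).mul (hasFDerivAt_coord l y)).mul h2).const_sub (if j = l then 1 else 0)
  have e : (fun z => gram z j l) =
      fun z => (if j = l then 1 else 0) - z j * z l * (height z ^ 2)⁻¹ := by
    ext z
    exact gram_apply z j l
  rw [coordDeriv, e]
  erw [h.fderiv]
  have e1 : y 0 * (Pi.single i 1 : Coord) 0 + y 1 * (Pi.single i 1 : Coord) 1 = y i := by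
    fin_cases i <;> simp
  have e2 : ∀ k, (Pi.single i 1 : Coord) k = if i = k then 1 else 0 := by
    intro k
    simp [Pi.single_apply, eq_comm]
  generalize (Pi.single i 1 : Coord) = w at e1 e2
  simp only [neg_apply, add_apply,
    smul_apply, coordCLM_apply, smul_eq_mul, e1, Pi.mul_apply]
  rw [e2 j, e2 l]
  split_ifs <;> simp <;> field_simp <;> ring

/-- The hyperboloid is umbilic: the second derivatives of the embedding X satisfy ∂_i∂_j X =
Γ^k_{ij} ∂_k X + g_{ij} X. The spatial components of X are the coordinates themselves, so there the
left side is zero. -/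
theorem christoffel_eq (k i j : Fin 2) (y : Coord) :
    christoffel k i j y = -(y k * gram y i j) := by
  have h : (1 + y 0 ^ 2 + y 1 ^ 2) * (height y ^ 2)⁻¹ = 1 := by
    rw [← height_sq, mul_inv_cancel₀ (pow_ne_zero 2 (height_pos y).ne')]
  rw [christoffel, inv_gram, Fin.sum_univ_two]
  simp only [coordDeriv_gram, Matrix.of_apply]
  simp only [gram_apply]
  generalize (height y ^ 2)⁻¹ = q at h ⊢
  -- This multiple of `h` is the discrepancy in every component, so one combination closes all eight
  -- cases.
  have key := congrArg (fun s => y k * (-(if i = j then 1 else 0) + y i * y j * q) * s) h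
  fin_cases k <;> fin_cases i <;> fin_cases j <;> simp at key ⊢ <;> linear_combination key

theorem hor_eq (y v a : Coord) : hor y v a = (a, metric y v a • y) := by
  have hH := (height_pos y).ne'
  refine Prod.ext rfl ?_
  ext k
  simp [hor, christoffel_eq, gram_apply, metric_eq, vheight, Fin.sum_univ_two]
  field_simp
  ring

/-! ### The energy and its comparison with Euclidean quantities. -/

/-- The squared length `g_y(v, v)` of a tangent vector. -/
noncomputable def energy (p : TH2) : ℝ := metric p.1 p.2 p.2

theorem height_eq_of_sq {y : Coord} {s : ℝ} (h : s ^ 2 = 1 + y 0 ^ 2 + y 1 ^ 2) (hs : 0 < s) :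
    height y = s := by
  rw [height, ← h, Real.sqrt_sq hs.le]

theorem vheight_eq_of_mul {y v : Coord} {s : ℝ} (h : height y * s = y 0 * v 0 + y 1 * v 1) :
    vheight y v = s := by
  rw [vheight, ← h, mul_div_cancel_left₀ _ (height_pos y).ne']

theorem energy_eq (p : TH2) :
    energy p = p.2 0 ^ 2 + p.2 1 ^ 2 - vheight p.1 p.2 ^ 2 := metric_self_eq _ _

/-- Lagrange's identity applied to (1 + |y|²)|v|² - (y·v)². It yields the positivity of the metric
and isolates the component of v across y. -/
theorem height_sq_mul_energy (p : TH2) :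
    height p.1 ^ 2 * energy p =
      p.2 0 ^ 2 + p.2 1 ^ 2 + (p.1 0 * p.2 1 - p.1 1 * p.2 0) ^ 2 := by
  have h := height_sq p.1
  have h1 := height_mul_vheight p.1 p.2
  rw [energy_eq]
  linear_combination (p.2 0 ^ 2 + p.2 1 ^ 2) * h
    - (height p.1 * vheight p.1 p.2 + (p.1 0 * p.2 0 + p.1 1 * p.2 1)) * h1

theorem energy_nonneg (p : TH2) : 0 ≤ energy p := by
  have h := height_sq_mul_energy p
  have h1 := pow_pos (height_pos p.1) 2
  by_contra! hneg
  nlinarith [mul_pos_of_neg_of_neg hneg (neg_neg_of_pos h1), sq_nonneg (p.2 0),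
    sq_nonneg (p.2 1), sq_nonneg (p.1 0 * p.2 1 - p.1 1 * p.2 0)]

theorem sq_add_sq_le_height_sq_mul_energy (p : TH2) :
    p.2 0 ^ 2 + p.2 1 ^ 2 ≤ height p.1 ^ 2 * energy p := by
  rw [height_sq_mul_energy]
  linarith [sq_nonneg (p.1 0 * p.2 1 - p.1 1 * p.2 0)]

theorem snd_eq_zero_of_energy_eq_zero {p : TH2} (h : energy p = 0) : p.2 = 0 := by
  have h1 := sq_add_sq_le_height_sq_mul_energy p
  rw [h, mul_zero] at h1
  ext i
  fin_cases i <;> simp <;> nlinarith [sq_nonneg (p.2 0), sq_nonneg (p.2 1)]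

theorem vheight_sq_le (p : TH2) :
    vheight p.1 p.2 ^ 2 ≤ (height p.1 ^ 2 - 1) * energy p := by
  have h := height_sq p.1
  have h1 := height_mul_vheight p.1 p.2
  have e : (height p.1 ^ 2 - 1) * energy p - vheight p.1 p.2 ^ 2
      = (p.1 0 * p.2 1 - p.1 1 * p.2 0) ^ 2 := by
    rw [energy_eq]
    linear_combination (p.2 0 ^ 2 + p.2 1 ^ 2) * h
      - (height p.1 * vheight p.1 p.2 + (p.1 0 * p.2 0 + p.1 1 * p.2 1)) * h1
  linarith [sq_nonneg (p.1 0 * p.2 1 - p.1 1 * p.2 0)]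

/-! ### The explicit geodesic flow. -/

/-- `cosh (√E t)`, the solution of `u'' = E u` with `u(0) = 1`, `u'(0) = 0`. -/
noncomputable def cosine (E t : ℝ) : ℝ := Real.cosh (√E * t)

/-- `sinh (√E t) / √E`, the solution of `u'' = E u` with `u(0) = 0`, `u'(0) = 1`, for `E > 0`. -/
noncomputable def sine (E t : ℝ) : ℝ := Real.sinh (√E * t) / √E

theorem cosine_sq {E : ℝ} (hE : 0 ≤ E) (t : ℝ) : cosine E t ^ 2 = 1 + E * sine E t ^ 2 := by
  rcases hE.eq_or_lt with rfl | h
  · simp [cosine]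
  · have h1 : √E ≠ 0 := (Real.sqrt_pos.2 h).ne'
    have h2 := Real.cosh_sq (√E * t)
    have h3 := Real.sq_sqrt hE
    rw [cosine, sine, div_pow, h3, h2]
    field_simp
    ring

theorem one_le_cosine (E t : ℝ) : 1 ≤ cosine E t := Real.one_le_cosh _

theorem cosine_neg (E t : ℝ) : cosine E (-t) = cosine E t := by simp [cosine]

theorem sine_neg (E t : ℝ) : sine E (-t) = -sine E t := by simp [sine, neg_div]

theorem cosine_add {E : ℝ} (hE : 0 ≤ E) (s t : ℝ) :
    cosine E (s + t) = cosine E s * cosine E t + E * sine E s * sine E t := by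
  rcases hE.eq_or_lt with rfl | h
  · simp [cosine]
  · have h1 : √E ≠ 0 := (Real.sqrt_pos.2 h).ne'
    have h3 := Real.sq_sqrt hE
    rw [cosine, cosine, cosine, sine, sine, mul_add, Real.cosh_add]
    field_simp
    linear_combination (Real.sinh (√E * s) * Real.sinh (√E * t)) * h3

theorem sine_add (E s t : ℝ) :
    sine E (s + t) = sine E s * cosine E t + cosine E s * sine E t := by
  rw [sine, sine, sine, cosine, cosine, mul_add, Real.sinh_add]
  ring

/-- The geodesic flow on `Tℍ²`. -/
noncomputable def geodesicFlow (t : ℝ) (p : TH2) : TH2 :=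
  (cosine (energy p) t • p.1 + sine (energy p) t • p.2,
    (energy p * sine (energy p) t) • p.1 + cosine (energy p) t • p.2)

theorem height_geodesicFlow (t : ℝ) (p : TH2) :
    height (geodesicFlow t p).1 =
      cosine (energy p) t * height p.1 + sine (energy p) t * vheight p.1 p.2 := by
  have hE := energy_nonneg p
  have hc := cosine_sq hE t
  have hc1 := one_le_cosine (energy p) t
  have h := height_sq p.1
  have hH := one_le_height p.1
  have h1 := height_mul_vheight p.1 p.2
  have h2 := energy_eq p
  have h3 := vheight_sq_le p
  refine height_eq_of_sq ?_ ?_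
  · simp only [geodesicFlow, Pi.add_apply, Pi.smul_apply, smul_eq_mul]
    linear_combination cosine (energy p) t ^ 2 * h + 2 * cosine (energy p) t * sine (energy p) t * h1
      + hc + sine (energy p) t ^ 2 * h2
  -- With C, S, H, V for the four factors: S²V² ≤ E S² (H² - 1) = (C² - 1)(H² - 1) < C²H², so the
  -- orbit stays on the upper branch.
  · have h4 : (sine (energy p) t * vheight p.1 p.2) ^ 2 < (cosine (energy p) t * height p.1) ^ 2 := by
      nlinarith [mul_le_mul_of_nonneg_left h3 (sq_nonneg (sine (energy p) t))]
    have h5 := abs_lt_of_sq_lt_sq h4 (by positivity)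
    linarith [(abs_lt.1 h5).1]

theorem vheight_geodesicFlow (t : ℝ) (p : TH2) :
    vheight (geodesicFlow t p).1 (geodesicFlow t p).2 =
      energy p * sine (energy p) t * height p.1 + cosine (energy p) t * vheight p.1 p.2 := by
  have h := height_sq p.1
  have h1 := height_mul_vheight p.1 p.2
  have h2 := energy_eq p
  refine vheight_eq_of_mul ?_
  rw [height_geodesicFlow]
  simp only [geodesicFlow, Pi.add_apply, Pi.smul_apply, smul_eq_mul]
  linear_combination cosine (energy p) t * sine (energy p) t * energy p * h
    + (cosine (energy p) t ^ 2 + energy p * sine (energy p) t ^ 2) * h1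
    + cosine (energy p) t * sine (energy p) t * h2

theorem energy_geodesicFlow (t : ℝ) (p : TH2) : energy (geodesicFlow t p) = energy p := by
  have hc := cosine_sq (energy_nonneg p) t
  have h := height_sq p.1
  have h1 := height_mul_vheight p.1 p.2
  have h2 := energy_eq p
  rw [energy_eq, vheight_geodesicFlow]
  simp only [geodesicFlow, Pi.add_apply, Pi.smul_apply, smul_eq_mul]
  linear_combination energy p * hc - (energy p * sine (energy p) t) ^ 2 * h
    - 2 * cosine (energy p) t * sine (energy p) t * energy p * h1
    - cosine (energy p) t ^ 2 * h2

theorem geodesicFlow_add (s t : ℝ) (p : TH2) :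
    geodesicFlow (s + t) p = geodesicFlow s (geodesicFlow t p) := by
  have h1 := cosine_add (energy_nonneg p) s t
  have h2 := sine_add (energy p) s t
  conv_rhs => rw [geodesicFlow, energy_geodesicFlow]
  refine Prod.ext ?_ ?_
  · ext i
    simp only [geodesicFlow, Pi.add_apply, Pi.smul_apply, smul_eq_mul]
    linear_combination p.1 i * h1 + p.2 i * h2
  · ext i
    simp only [geodesicFlow, Pi.add_apply, Pi.smul_apply, smul_eq_mul]
    linear_combination p.1 i * energy p * h2 + p.2 i * h1

@[simp] theorem geodesicFlow_zero (p : TH2) : geodesicFlow 0 p = p := by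
  simp [geodesicFlow, cosine, sine]

theorem geodesicFlow_neg_cancel (t : ℝ) (p : TH2) :
    geodesicFlow t (geodesicFlow (-t) p) = p := by
  rw [← geodesicFlow_add, add_neg_cancel, geodesicFlow_zero]

/-- The generator of the geodesic flow. -/
theorem hor_self_eq (p : TH2) : hor p.1 p.2 p.2 = (p.2, energy p • p.1) := hor_eq _ _ _

theorem hasDerivAt_geodesicFlow (t : ℝ) (p : TH2) :
    HasDerivAt (fun s => geodesicFlow s p)
      (hor (geodesicFlow t p).1 (geodesicFlow t p).2 (geodesicFlow t p).2) t := by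
  rw [hor_self_eq, energy_geodesicFlow]
  -- For E = 0 the quotient defining `sine` is 0 instead of t. This is harmless, because then v = 0
  -- and the orbit is constant.
  rcases (energy_nonneg p).eq_or_lt with h | h
  · have h2 := snd_eq_zero_of_energy_eq_zero h.symm
    have : (fun s => geodesicFlow s p) = fun _ => p := by
      ext1 s
      refine Prod.ext ?_ ?_ <;> simp [geodesicFlow, ← h, h2, cosine]
    rw [this, ← h]
    refine (hasDerivAt_const t p).congr_deriv ?_
    simp only [geodesicFlow, ← h, h2, zero_smul, smul_zero, zero_mul, add_zero]
    rfl
  · have h1 : √(energy p) ≠ 0 := (Real.sqrt_pos.2 h).ne'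
    have h3 := Real.sq_sqrt h.le
    have hl : HasDerivAt (fun s => √(energy p) * s) √(energy p) t := by
      simpa using (hasDerivAt_id t).const_mul √(energy p)
    have hC : HasDerivAt (cosine (energy p)) (energy p * sine (energy p) t) t := by
      refine hl.cosh.congr_deriv ?_
      rw [sine]
      field_simp
      linear_combination Real.sinh (√(energy p) * t) * h3
    have hS : HasDerivAt (sine (energy p)) (cosine (energy p) t) t := by
      refine (hl.sinh.div_const _).congr_deriv ?_
      rw [cosine]
      field_simp
    refine HasDerivAt.prodMk ((hC.smul_const p.1).add (hS.smul_const p.2)) ?_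
    refine (((hS.const_mul (energy p)).smul_const p.1).add (hC.smul_const p.2)).congr_deriv ?_
    simp only [geodesicFlow, smul_add, smul_smul]

theorem contDiff_vheight {n : WithTop ℕ∞} : ContDiff ℝ n fun p : TH2 => vheight p.1 p.2 := by
  unfold vheight
  refine ContDiff.div (by fun_prop) (contDiff_height.comp contDiff_fst) fun p => ?_
  exact (height_pos _).ne'

theorem contDiff_energy {n : WithTop ℕ∞} : ContDiff ℝ n energy := by
  have : energy = fun p : TH2 => p.2 0 ^ 2 + p.2 1 ^ 2 - vheight p.1 p.2 ^ 2 := funext energy_eq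
  rw [this]
  exact ContDiff.sub (by fun_prop) (contDiff_vheight.pow 2)

theorem contDiffAt_geodesicFlow {n : WithTop ℕ∞} {t : ℝ} {p : TH2} (hp : 0 < energy p) :
    ContDiffAt ℝ n (fun q : ℝ × TH2 => geodesicFlow q.1 q.2) (t, p) := by
  have hE : ContDiffAt ℝ n (fun q : ℝ × TH2 => energy q.2) (t, p) :=
    (contDiff_energy.comp contDiff_snd).contDiffAt
  have hR : ContDiffAt ℝ n (fun q : ℝ × TH2 => √(energy q.2)) (t, p) := hE.sqrt hp.ne'
  have hRt := hR.mul contDiffAt_fst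
  have hC : ContDiffAt ℝ n (fun q : ℝ × TH2 => cosine (energy q.2) q.1) (t, p) := hRt.cosh
  have hS : ContDiffAt ℝ n (fun q : ℝ × TH2 => sine (energy q.2) q.1) (t, p) :=
    hRt.sinh.div hR (Real.sqrt_pos.2 hp).ne'
  have h1 : ContDiffAt ℝ n (fun q : ℝ × TH2 => q.2.1) (t, p) := by fun_prop
  have h2 : ContDiffAt ℝ n (fun q : ℝ × TH2 => q.2.2) (t, p) := by fun_prop
  exact ((hC.smul h1).add (hS.smul h2)).prodMk (((hE.mul hS).smul h1).add (hC.smul h2))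

/-! ### Existence and uniqueness of Vlasov fields by transport. -/

/-- The function `f₀` transported along the geodesic flow. -/
noncomputable def transport (f₀ : TH2 → ℝ) (t : ℝ) (p : TH2) : ℝ := f₀ (geodesicFlow (-t) p)

/-- Smoothness of the flow is only available where the energy is positive. Below energy α² the
transported function vanishes on an open set, by conservation of energy. -/
theorem contDiff_transport {α : ℝ} (hα : 0 < α) {f₀ : TH2 → ℝ} (hf : ContDiff ℝ 1 f₀)
    (hs : Function.support f₀ ⊆ energySet α) :
    ContDiff ℝ 1 fun q : ℝ × TH2 => transport f₀ q.1 q.2 := by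
  rw [contDiff_iff_contDiffAt]
  rintro ⟨t, p⟩
  rcases lt_or_ge (energy p) (α ^ 2) with h | h
  · have h1 : ∀ᶠ q : ℝ × TH2 in nhds (t, p), energy q.2 < α ^ 2 :=
      (contDiff_energy (n := 0).continuous.comp continuous_snd).continuousAt.eventually_lt_const h
    refine (contDiffAt_const (c := (0 : ℝ))).congr_of_eventuallyEq ?_
    filter_upwards [h1] with q hq
    by_contra hne
    have h2 : α ^ 2 ≤ energy (geodesicFlow (-q.1) q.2) := hs hne
    rw [energy_geodesicFlow] at h2
    linarith
  · have hp : 0 < energy p := lt_of_lt_of_le (by positivity) h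
    have h1 : ContDiffAt ℝ 1 (fun q : ℝ × TH2 => ((-q.1, q.2) : ℝ × TH2)) (t, p) := by fun_prop
    have h2 : ContDiffAt ℝ 1 (fun q : ℝ × TH2 => geodesicFlow (-q.1) q.2) (t, p) :=
      ContDiffAt.comp (f := fun q : ℝ × TH2 => ((-q.1, q.2) : ℝ × TH2)) (t, p)
        (contDiffAt_geodesicFlow (t := -t) hp) h1
    exact hf.contDiffAt.comp _ h2

/-- The transported function at time t + s, evaluated at the image of p under the flow for time s,
does not depend on s; its derivative at s = 0 is the Vlasov equation. -/
theorem isVlasovField_transport {α : ℝ} (hα : 0 < α) {f₀ : TH2 → ℝ} (hf : ContDiff ℝ 1 f₀)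
    (hs : Function.support f₀ ⊆ energySet α) : IsVlasovField (transport f₀) where
  contDiffOn := (contDiff_transport hα hf hs).contDiffOn
  vlasov t ht y v := by
    set p : TH2 := (y, v) with hp
    have hD := ((contDiff_transport hα hf hs).differentiable one_ne_zero (t, p)).hasFDerivAt
    set D := fderiv ℝ (fun q : ℝ × TH2 => transport f₀ q.1 q.2) (t, p)
    have h1 : HasDerivAt (fun s => transport f₀ s p) (D (1, 0)) t :=
      HasFDerivAt.comp_hasDerivAt (f := fun s => (s, p)) t hD ((hasDerivAt_id t).prodMk (hasDerivAt_const t p))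
    have h2 : HasFDerivAt (transport f₀ t) (D.comp (ContinuousLinearMap.inr ℝ ℝ TH2)) p :=
      HasFDerivAt.comp p hD (hasFDerivAt_prodMk_right t p)
    have hflow := hasDerivAt_geodesicFlow 0 p
    rw [geodesicFlow_zero] at hflow
    have h3 : HasDerivAt (fun s => transport f₀ (t + s) (geodesicFlow s p))
        (D (1, hor y v v)) 0 := by
      refine HasFDerivAt.comp_hasDerivAt (f := fun s => (t + s, geodesicFlow s p))
        (l := fun q : ℝ × TH2 => transport f₀ q.1 q.2) 0 ?_ (((hasDerivAt_id 0).const_add t).prodMk hflow)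
      simpa using hD
    have h4 : (fun s => transport f₀ (t + s) (geodesicFlow s p)) = fun _ => transport f₀ t p := by
      ext s
      rw [transport, ← geodesicFlow_add, transport]
      congr 2
      ring
    rw [h4] at h3
    rw [h1.hasDerivWithinAt.derivWithin (uniqueDiffOn_Ici 0 t ht), h2.fderiv,
      ContinuousLinearMap.comp_apply, ContinuousLinearMap.inr_apply, ← map_add,
      Prod.mk_add_mk, add_zero, zero_add]
    exact h3.unique (hasDerivAt_const _ _)

/-- Method of characteristics: by the Vlasov equation the field has zero derivative along every
orbit on [0, ∞). -/
theorem IsVlasovField.eq_transport {f : ℝ → TH2 → ℝ} (hf : IsVlasovField f) {t : ℝ} (ht : 0 ≤ t)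
    (p : TH2) : f t p = transport (f 0) t p := by
  have key : ∀ q : TH2, ∀ s : ℝ, 0 ≤ s →
      HasDerivWithinAt (fun s => f s (geodesicFlow s q)) 0 (Set.Ici 0) s := by
    intro q s hs
    set P := geodesicFlow s q with hP
    have hD := ((hf.contDiffOn.differentiableOn one_ne_zero) (s, P)
      ⟨hs, Set.mem_univ _⟩).hasFDerivWithinAt
    set D := fderivWithin ℝ (fun q : ℝ × TH2 => f q.1 q.2) (Set.Ici 0 ×ˢ Set.univ) (s, P)
    have h1 : HasDerivWithinAt (fun s => f s P) (D (1, 0)) (Set.Ici 0) s :=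
      HasFDerivWithinAt.comp_hasDerivWithinAt (f := fun s => (s, P)) s hD
        ((hasDerivWithinAt_id s _).prodMk (hasDerivWithinAt_const s _ P))
        (fun x hx => ⟨hx, Set.mem_univ _⟩)
    have h2 : HasFDerivAt (f s) (D.comp (ContinuousLinearMap.inr ℝ ℝ TH2)) P := by
      rw [← hasFDerivWithinAt_univ]
      exact HasFDerivWithinAt.comp (f := fun z => (s, z)) P hD
        (hasFDerivAt_prodMk_right s P).hasFDerivWithinAt (fun x _ => ⟨hs, Set.mem_univ _⟩)
    have h3 : HasDerivWithinAt (fun s => f s (geodesicFlow s q)) (D (1, hor P.1 P.2 P.2))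
        (Set.Ici 0) s :=
      HasFDerivWithinAt.comp_hasDerivWithinAt (f := fun s => (s, geodesicFlow s q)) s hD
        ((hasDerivWithinAt_id s _).prodMk (hasDerivAt_geodesicFlow s q).hasDerivWithinAt)
        (fun x hx => ⟨hx, Set.mem_univ _⟩)
    have h4 := hf.vlasov s hs P.1 P.2
    rw [h1.derivWithin (uniqueDiffOn_Ici 0 s hs), h2.fderiv,
      ContinuousLinearMap.comp_apply, ContinuousLinearMap.inr_apply, ← map_add,
      Prod.mk_add_mk, add_zero, zero_add] at h4
    rwa [h4] at h3
  set q := geodesicFlow (-t) p with hq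
  have h := constant_of_has_deriv_right_zero (f := fun s => f s (geodesicFlow s q))
    (a := 0) (b := t) (fun s hs => ((key q s hs.1).continuousWithinAt).mono Set.Icc_subset_Ici_self)
    (fun s hs => (key q s hs.1).mono (Set.Ici_subset_Ici.2 hs.1)) t (Set.right_mem_Icc.2 ht)
  simpa [hq, geodesicFlow_neg_cancel, transport] using h

/-! ### Decay of velocity averages. -/

/-- The tangent vectors with length between `α` and `β` over a ball of the hyperbolic plane. -/
def shell (α β L : ℝ) : Set TH2 := {p | α ^ 2 ≤ energy p ∧ energy p ≤ β ^ 2 ∧ height p.1 ≤ L}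

theorem exists_unit_direction (y : Coord) :
    ∃ c s : ℝ, c ^ 2 + s ^ 2 = 1 ∧ c * y 1 = s * y 0 := by
  by_cases h : y 0 ^ 2 + y 1 ^ 2 = 0
  · have h0 : y 0 = 0 := by nlinarith [sq_nonneg (y 0), sq_nonneg (y 1)]
    have h1 : y 1 = 0 := by nlinarith [sq_nonneg (y 0), sq_nonneg (y 1)]
    exact ⟨1, 0, by norm_num, by simp [h0, h1]⟩
  · have hp : 0 ≤ y 0 ^ 2 + y 1 ^ 2 := by positivity
    refine ⟨y 0 / √(y 0 ^ 2 + y 1 ^ 2), y 1 / √(y 0 ^ 2 + y 1 ^ 2), ?_, by ring⟩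
    rw [div_pow, div_pow, Real.sq_sqrt hp, ← add_div, div_self h]

theorem exp_le_two_mul_cosine {α E t : ℝ} (hα : 0 < α) (ht : 0 ≤ t) (hE : α ^ 2 ≤ E) :
    Real.exp (α * t) ≤ 2 * cosine E t := by
  have h1 : α ≤ √E := Real.le_sqrt_of_sq_le hE
  have h2 : Real.cosh (α * t) ≤ cosine E t := by
    rw [cosine, Real.cosh_le_cosh, abs_of_nonneg (by positivity), abs_of_nonneg (by positivity)]
    gcongr
  have h3 := Real.cosh_eq (α * t)
  have h4 := Real.exp_pos (-(α * t))
  linarith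

/-- Only the points far out are reached at late times. -/
theorem exp_le_height_of_mem_shell {α β L t : ℝ} (hα : 0 < α) (ht : 0 ≤ t) {p : TH2}
    (hp : geodesicFlow (-t) p ∈ shell α β L) : Real.exp (α * t) ≤ 4 * L * height p.1 := by
  set q := geodesicFlow (-t) p with hq
  obtain ⟨h1, -, h3⟩ := hp
  have hpq : geodesicFlow t q = p := geodesicFlow_neg_cancel t p
  rw [← hpq, height_geodesicFlow]
  have hE := energy_nonneg q
  have hc := cosine_sq hE t
  have hc1 := one_le_cosine (energy q) t
  have hexp := exp_le_two_mul_cosine hα ht h1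
  have hH := one_le_height q.1
  have hv := vheight_sq_le q
  set H := height q.1
  set C := cosine (energy q) t
  set S := sine (energy q) t
  set V := vheight q.1 q.2
  have hr := Real.sq_sqrt (show 0 ≤ H ^ 2 - 1 by nlinarith)
  have hr0 := Real.sqrt_nonneg (H ^ 2 - 1)
  set r := √(H ^ 2 - 1)
  have hrH : r ≤ H := by nlinarith
  have h5 : |S * V| ≤ C * r := by
    refine abs_le_of_sq_le_sq ?_ (by positivity)
    nlinarith [mul_le_mul_of_nonneg_left hv (sq_nonneg S)]
  have h6 : C * (H - r) ≤ C * H + S * V := by linarith [(abs_le.1 h5).1]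
  -- H - r = 1/(H + r), and H + r ≤ 2H ≤ 2L.
  have h7 : 1 ≤ 2 * L * (H - r) := by nlinarith
  have hL : 0 < L := by linarith
  nlinarith

/-- In the frame aligned with y, let a and b be the components of v along and across y. The bound
for a follows from H²E = a² + H²b². The backward base point is C y - S v, with transverse component
-S b, so |S b| ≤ L; this and C² = 1 + E S² bound C b, and C ≥ e^{αt}/2. -/
theorem abs_le_of_mem_shell {α β L t c s : ℝ} (hα : 0 < α) (hβ : 0 ≤ β) (ht : 0 ≤ t)
    (hcs : c ^ 2 + s ^ 2 = 1) {y v : Coord} (hy : c * y 1 = s * y 0)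
    (hp : geodesicFlow (-t) (y, v) ∈ shell α β L) :
    |c * v 0 + s * v 1| ≤ β * height y ∧
      |-s * v 0 + c * v 1| ≤ 4 * L * β * Real.exp (-(α * t)) := by
  obtain ⟨h1, h2, h3⟩ := hp
  have hx := height_sq (geodesicFlow (-t) (y, v)).1
  have hx1 := one_le_height (geodesicFlow (-t) (y, v)).1
  rw [energy_geodesicFlow] at h1 h2
  set X := height (geodesicFlow (-t) (y, v)).1
  simp only [geodesicFlow, sine_neg, cosine_neg, Pi.add_apply, Pi.smul_apply, smul_eq_mul] at hx
  have hE := energy_nonneg (y, v)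
  have hHE := height_sq_mul_energy (y, v)
  have hc := cosine_sq hE t
  have hexp := exp_le_two_mul_cosine hα ht h1
  have hH := height_sq y
  have hH0 := height_pos y
  simp only at hHE
  set E := energy (y, v)
  set C := cosine E t
  set S := sine E t
  set H := height y
  set a := c * v 0 + s * v 1 with ha
  set b := -s * v 0 + c * v 1 with hb
  set ρ := c * y 0 + s * y 1 with hρ
  have hab : v 0 ^ 2 + v 1 ^ 2 = a ^ 2 + b ^ 2 := by
    rw [ha, hb]
    linear_combination -(v 0 ^ 2 + v 1 ^ 2) * hcs
  have hy0 : y 0 = ρ * c := by rw [hρ]; linear_combination -y 0 * hcs - s * hy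
  have hy1 : y 1 = ρ * s := by rw [hρ]; linear_combination -y 1 * hcs + c * hy
  have hb' : y 0 * v 1 - y 1 * v 0 = ρ * b := by rw [hy0, hy1, hb]; ring
  have hHρ : H ^ 2 = 1 + ρ ^ 2 := by rw [hH, hy0, hy1]; linear_combination ρ ^ 2 * hcs
  have hEab : H ^ 2 * E = a ^ 2 + H ^ 2 * b ^ 2 := by
    rw [hHE, hb', hab]; linear_combination -b ^ 2 * hHρ
  constructor
  · refine abs_le_of_sq_le_sq ?_ (by positivity)
    nlinarith [mul_le_mul_of_nonneg_left h2 (sq_nonneg H), sq_nonneg (H * b)]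
  · have hSb : (S * b) ^ 2 ≤ X ^ 2 := by
      have e : -s * (C * y 0 + -S * v 0) + c * (C * y 1 + -S * v 1) = -(S * b) := by
        rw [hb]; linear_combination C * hy
      have e2 := sq_nonneg (c * (C * y 0 + -S * v 0) + s * (C * y 1 + -S * v 1))
      have e3 : (C * y 0 + -S * v 0) ^ 2 + (C * y 1 + -S * v 1) ^ 2
          = (-(S * b)) ^ 2 + (c * (C * y 0 + -S * v 0) + s * (C * y 1 + -S * v 1)) ^ 2 := by
        rw [← e]
        linear_combination -((C * y 0 + -S * v 0) ^ 2 + (C * y 1 + -S * v 1) ^ 2) * hcs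
      rw [neg_sq] at e3
      linarith
    have hXL : X ^ 2 ≤ L ^ 2 := by gcongr
    have hL : 0 < L := by linarith
    have hbE : b ^ 2 ≤ E := by
      have : H ^ 2 * b ^ 2 ≤ H ^ 2 * E := by linarith [sq_nonneg a]
      exact le_of_mul_le_mul_left this (by positivity)
    have hCb : (C * b) ^ 2 ≤ (2 * L * β) ^ 2 := by
      have h4 : E * (S * b) ^ 2 ≤ β ^ 2 * L ^ 2 :=
        mul_le_mul h2 (hSb.trans hXL) (sq_nonneg _) (sq_nonneg _)
      have h5 : β ^ 2 * 1 ≤ β ^ 2 * L ^ 2 := by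
        refine mul_le_mul_of_nonneg_left ?_ (sq_nonneg β)
        exact one_le_pow₀ (by linarith)
      have h6 : (C * b) ^ 2 = b ^ 2 + E * (S * b) ^ 2 := by linear_combination b ^ 2 * hc
      have h7 : (2 * L * β) ^ 2 = 4 * (β ^ 2 * L ^ 2) := by ring
      linarith [mul_nonneg (sq_nonneg β) (sq_nonneg L)]
    have hCb' := abs_le_of_sq_le_sq hCb (by positivity)
    rw [abs_mul, abs_of_pos (by linarith [one_le_cosine E t] : 0 < C)] at hCb'
    have h6 : Real.exp (α * t) * |b| ≤ 4 * L * β := by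
      linarith [mul_le_mul_of_nonneg_right hexp (abs_nonneg b)]
    rw [Real.exp_neg, ← div_eq_mul_inv, le_div_iff₀ (Real.exp_pos _)]
    linarith

/-- The rotation aligned with y preserves area and takes the set into a box with sides 2βH and
8Lβe^{-αt}. -/
theorem volume_shell_fiber_le {α β L t : ℝ} (hα : 0 < α) (hβ : 0 ≤ β) (ht : 0 ≤ t)
    (y : Coord) : volume {v : Coord | geodesicFlow (-t) (y, v) ∈ shell α β L} ≤
      ENNReal.ofReal (16 * L * β ^ 2 * Real.exp (-(α * t)) * height y) := by
  obtain ⟨c, s, hcs, hy⟩ := exists_unit_direction y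
  set A : Coord →ₗ[ℝ] Coord := Matrix.toLin' !![c, s; -s, c] with hA
  have hdet : LinearMap.det A = 1 := by
    rw [hA, LinearMap.det_toLin', Matrix.det_fin_two_of]
    linear_combination hcs
  set w : Coord := ![β * height y, 4 * L * β * Real.exp (-(α * t))] with hw
  have hsub : {v : Coord | geodesicFlow (-t) (y, v) ∈ shell α β L} ⊆ A ⁻¹' Set.Icc (-w) w := by
    intro v hv
    obtain ⟨h1, h2⟩ := abs_le_of_mem_shell hα hβ ht hcs hy hv
    rw [abs_le] at h1 h2
    constructor
    · intro i
      fin_cases i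
      · simpa [hA, hw, Matrix.mulVec, dotProduct, Fin.sum_univ_two] using h1.1
      · simpa [hA, hw, Matrix.mulVec, dotProduct, Fin.sum_univ_two] using h2.1
    · intro i
      fin_cases i
      · simpa [hA, hw, Matrix.mulVec, dotProduct, Fin.sum_univ_two] using h1.2
      · simpa [hA, hw, Matrix.mulVec, dotProduct, Fin.sum_univ_two] using h2.2
  refine (measure_mono hsub).trans_eq ?_
  have hH := (height_pos y).le
  rw [Measure.addHaar_preimage_linearMap _ (by rw [hdet]; exact one_ne_zero), hdet,
    Real.volume_Icc_pi, Fin.prod_univ_two, ← ENNReal.ofReal_mul, ← ENNReal.ofReal_mul (by simp)]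
  · congr 1
    simp [hw]
    ring
  · simp [hw]
    positivity

/-- Decay of velocity averages of functions supported in a shell. -/
theorem abs_integral_transport_le {α β L t M : ℝ} (hα : 0 < α) (hβ : 0 ≤ β) (hL : 0 ≤ L)
    (ht : 0 ≤ t) {F : TH2 → ℝ} (hF : Function.support F ⊆ shell α β L) (hM : ∀ p, |F p| ≤ M)
    (y : Coord) :
    |∫ v : Coord, transport F t (y, v)| ≤
      16 * L * β ^ 2 * Real.exp (-(α * t)) * height y * M := by
  set s := {v : Coord | geodesicFlow (-t) (y, v) ∈ shell α β L} with hs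
  have hvol := volume_shell_fiber_le (L := L) hα hβ ht y
  have h0 : ∀ v ∉ s, transport F t (y, v) = 0 := by
    intro v hv
    by_contra hne
    exact hv (hF hne)
  have hM0 : 0 ≤ M := (abs_nonneg _).trans (hM 0)
  rw [← setIntegral_eq_integral_of_forall_compl_eq_zero h0, ← Real.norm_eq_abs]
  have h1 := norm_setIntegral_le_of_norm_le_const (μ := volume) (s := s) (C := M)
    (f := fun v => transport F t (y, v)) (hvol.trans_lt ENNReal.ofReal_lt_top)
    (fun v _ => hM _)
  refine h1.trans ?_
  rw [mul_comm]
  refine mul_le_mul_of_nonneg_right ?_ hM0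
  have hH := (height_pos y).le
  exact ENNReal.toReal_le_of_le_ofReal (by positivity) hvol

/-! ### Boosts as isometries commuting with the flow. -/

/-- The spatial part of the image under the Minkowski boost of rapidity `ε` in the direction `n`
of the vector with time component `s` and spatial part `z`. -/
noncomputable def boostVec (n : Coord) (ε s : ℝ) (z : Coord) : Coord :=
  z + ((Real.cosh ε - 1) * (n 0 * z 0 + n 1 * z 1) + Real.sinh ε * s) • n

/-- The isometry of `ℍ²` given by a boost. -/
noncomputable def boostPoint (n : Coord) (ε : ℝ) (y : Coord) : Coord := boostVec n ε (height y) y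

/-- The action of a boost on `Tℍ²`. -/
noncomputable def boost (n : Coord) (ε : ℝ) (p : TH2) : TH2 :=
  (boostPoint n ε p.1, boostVec n ε (vheight p.1 p.2) p.2)

theorem sq_dot_le {n : Coord} (hn : n 0 ^ 2 + n 1 ^ 2 = 1)
    (y : Coord) : (n 0 * y 0 + n 1 * y 1) ^ 2 ≤ y 0 ^ 2 + y 1 ^ 2 := by
  have : y 0 ^ 2 + y 1 ^ 2 = (n 0 * y 0 + n 1 * y 1) ^ 2 + (n 0 * y 1 - n 1 * y 0) ^ 2 := by
    linear_combination -(y 0 ^ 2 + y 1 ^ 2) * hn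
  linarith [sq_nonneg (n 0 * y 1 - n 1 * y 0)]

theorem abs_dot_le_height {n : Coord} (hn : n 0 ^ 2 + n 1 ^ 2 = 1)
    (y : Coord) : |n 0 * y 0 + n 1 * y 1| ≤ height y := by
  refine abs_le_of_sq_le_sq ?_ (height_pos y).le
  linarith [sq_dot_le hn y, height_sq y]

theorem exp_neg_abs_mul_height_le {n : Coord} (hn : n 0 ^ 2 + n 1 ^ 2 = 1)
    (ε : ℝ) (y : Coord) : Real.exp (-|ε|) * height y ≤
    Real.cosh ε * height y + Real.sinh ε * (n 0 * y 0 + n 1 * y 1) := by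
  have h := abs_dot_le_height hn y
  have h1 : Real.exp (-|ε|) = Real.cosh ε - |Real.sinh ε| := by
    rw [Real.abs_sinh, ← Real.cosh_abs ε, Real.cosh_sub_sinh]
  have h2 : |Real.sinh ε * (n 0 * y 0 + n 1 * y 1)| ≤ |Real.sinh ε| * height y := by
    rw [abs_mul]
    gcongr
  rw [h1]
  linarith [(abs_le.1 h2).1]

theorem height_boostPoint {n : Coord} (hn : n 0 ^ 2 + n 1 ^ 2 = 1)
    (ε : ℝ) (y : Coord) : height (boostPoint n ε y) =
    Real.cosh ε * height y + Real.sinh ε * (n 0 * y 0 + n 1 * y 1) := by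
  have h := height_sq y
  have hc := Real.cosh_sq ε
  refine height_eq_of_sq ?_ ?_
  · simp only [boostPoint, boostVec, Pi.add_apply, Pi.smul_apply, smul_eq_mul]
    linear_combination h + (height y ^ 2 - (n 0 * y 0 + n 1 * y 1) ^ 2) * hc
      - ((Real.cosh ε - 1) * (n 0 * y 0 + n 1 * y 1) + Real.sinh ε * height y) ^ 2 * hn
  · refine lt_of_lt_of_le ?_ (exp_neg_abs_mul_height_le hn ε y)
    exact mul_pos (Real.exp_pos _) (height_pos y)

theorem height_le_three_mul_height_boostPoint {n : Coord} (hn : n 0 ^ 2 + n 1 ^ 2 = 1) {ε : ℝ} (hε : |ε| ≤ 1) (y : Coord) :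
    height y ≤ 3 * height (boostPoint n ε y) := by
  have h := exp_neg_abs_mul_height_le hn ε y
  rw [← height_boostPoint hn] at h
  have h1 : Real.exp |ε| ≤ 3 :=
    (Real.exp_le_exp.2 hε).trans (Real.exp_one_lt_d9.le.trans (by norm_num))
  have h2 : height y = Real.exp |ε| * (Real.exp (-|ε|) * height y) := by
    rw [← mul_assoc, ← Real.exp_add, add_neg_cancel, Real.exp_zero, one_mul]
  rw [h2]
  exact mul_le_mul h1 h (mul_pos (Real.exp_pos _) (height_pos y)).le (by norm_num)

theorem vheight_boost {n : Coord} (hn : n 0 ^ 2 + n 1 ^ 2 = 1)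
    (ε : ℝ) (p : TH2) : vheight (boost n ε p).1 (boost n ε p).2 =
    Real.cosh ε * vheight p.1 p.2 + Real.sinh ε * (n 0 * p.2 0 + n 1 * p.2 1) := by
  have h := height_mul_vheight p.1 p.2
  have hc := Real.cosh_sq ε
  refine vheight_eq_of_mul ?_
  simp only [boost]
  rw [height_boostPoint hn]
  simp only [boostPoint, boostVec, Pi.add_apply, Pi.smul_apply, smul_eq_mul]
  linear_combination h + (height p.1 * vheight p.1 p.2
      - (n 0 * p.1 0 + n 1 * p.1 1) * (n 0 * p.2 0 + n 1 * p.2 1)) * hc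
    - ((Real.cosh ε - 1) * (n 0 * p.1 0 + n 1 * p.1 1) + Real.sinh ε * height p.1)
      * ((Real.cosh ε - 1) * (n 0 * p.2 0 + n 1 * p.2 1) + Real.sinh ε * vheight p.1 p.2) * hn

theorem energy_boost {n : Coord} (hn : n 0 ^ 2 + n 1 ^ 2 = 1)
    (ε : ℝ) (p : TH2) : energy (boost n ε p) = energy p := by
  have hc := Real.cosh_sq ε
  rw [energy_eq, energy_eq, vheight_boost hn]
  simp only [boost, boostVec, Pi.add_apply, Pi.smul_apply, smul_eq_mul]
  linear_combination ((n 0 * p.2 0 + n 1 * p.2 1) ^ 2 - vheight p.1 p.2 ^ 2) * hc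
    + ((Real.cosh ε - 1) * (n 0 * p.2 0 + n 1 * p.2 1) + Real.sinh ε * vheight p.1 p.2) ^ 2 * hn

/-- The flow forms linear combinations of x and v in Minkowski space with coefficients depending on
E and t only; a boost is linear there and preserves E. -/
theorem boost_geodesicFlow {n : Coord} (hn : n 0 ^ 2 + n 1 ^ 2 = 1) (ε t : ℝ) (p : TH2) :
    boost n ε (geodesicFlow t p) = geodesicFlow t (boost n ε p) := by
  rw [boost, boostPoint, height_geodesicFlow, vheight_geodesicFlow]
  conv_rhs => rw [geodesicFlow, energy_boost hn]
  refine Prod.ext ?_ ?_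
  · ext i
    simp only [geodesicFlow, boost, boostPoint, boostVec, Pi.add_apply, Pi.smul_apply, smul_eq_mul]
    ring
  · ext i
    simp only [geodesicFlow, boost, boostPoint, boostVec, Pi.add_apply, Pi.smul_apply, smul_eq_mul]
    ring

theorem hasDerivAt_boost {n : Coord} (hn : n 0 ^ 2 + n 1 ^ 2 = 1)
    (ε : ℝ) (p : TH2) : HasDerivAt (fun s => boost n s p)
    (height (boost n ε p).1 • n, vheight (boost n ε p).1 (boost n ε p).2 • n) ε := by
  have key : ∀ (s : ℝ) (z : Coord), HasDerivAt (fun r => boostVec n r s z)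
      ((Real.cosh ε * s + Real.sinh ε * (n 0 * z 0 + n 1 * z 1)) • n) ε := by
    intro s z
    refine HasDerivAt.const_add z (HasDerivAt.smul_const ?_ n)
    refine ((((Real.hasDerivAt_cosh ε).sub_const 1).mul_const _).add
      ((Real.hasDerivAt_sinh ε).mul_const s)).congr_deriv ?_
    ring
  rw [vheight_boost hn]
  have h := height_boostPoint hn ε p.1
  refine HasDerivAt.prodMk ?_ (key _ _)
  simp only [boost]
  rw [h]
  exact key _ _

theorem contDiff_boost {k : WithTop ℕ∞} (n : Coord) (ε : ℝ) : ContDiff ℝ k (boost n ε) := by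
  have h1 : ContDiff ℝ k fun p : TH2 => height p.1 := contDiff_height.comp contDiff_fst
  have h2 := contDiff_vheight (n := k)
  unfold boost boostPoint boostVec
  fun_prop

/-! ### The density: integrability, smoothness and equivariance under boosts. -/

theorem contDiff_transport_apply {α : ℝ} (hα : 0 < α) {F : TH2 → ℝ} (hF : ContDiff ℝ 1 F)
    (hs : Function.support F ⊆ energySet α) (t : ℝ) :
    ContDiff ℝ 1 (transport F t) :=
  ContDiff.comp (g := fun q : ℝ × TH2 => transport F q.1 q.2) (f := fun p => (t, p))
    (contDiff_transport hα hF hs) (contDiff_prodMk_right t)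

theorem shell_subset_energySet (α β L : ℝ) : shell α β L ⊆ energySet α := fun _ hp => hp.1

/-- The components of the tangent vectors at `y` of length at most `β` are bounded. -/
theorem mem_Icc_of_energy_le {β : ℝ} (hβ : 0 ≤ β) {y v : Coord} (h : energy (y, v) ≤ β ^ 2) :
    v ∈ Set.Icc (fun _ : Fin 2 => -(height y * β)) (fun _ => height y * β) := by
  have h1 := sq_add_sq_le_height_sq_mul_energy (y, v)
  simp only at h1
  have hH := height_pos y
  have h2 : height y ^ 2 * energy (y, v) ≤ (height y * β) ^ 2 := by
    rw [mul_pow]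
    gcongr
  have h3 : ∀ i, |v i| ≤ height y * β := by
    intro i
    refine abs_le_of_sq_le_sq ?_ (by positivity)
    fin_cases i
    · simp only [Fin.zero_eta]
      linarith [sq_nonneg (v 1)]
    · simp only [Fin.mk_one]
      linarith [sq_nonneg (v 0)]
  exact ⟨fun i => (abs_le.1 (h3 i)).1, fun i => (abs_le.1 (h3 i)).2⟩

theorem transport_eq_zero {α β L t : ℝ} (hβ : 0 ≤ β) {F : TH2 → ℝ}
    (hs : Function.support F ⊆ shell α β L) {y v : Coord}
    (hv : v ∉ Set.Icc (fun _ : Fin 2 => -(height y * β)) (fun _ => height y * β)) :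
    transport F t (y, v) = 0 := by
  by_contra hne
  have h1 : geodesicFlow (-t) (y, v) ∈ shell α β L := hs hne
  refine hv (mem_Icc_of_energy_le hβ ?_)
  rw [← energy_geodesicFlow (-t)]
  exact h1.2.1

theorem integrable_transport {α β L : ℝ} (hα : 0 < α) (hβ : 0 ≤ β) {F : TH2 → ℝ}
    (hF : ContDiff ℝ 1 F) (hs : Function.support F ⊆ shell α β L) (t : ℝ) (y : Coord) :
    Integrable fun v : Coord => transport F t (y, v) := by
  refine Continuous.integrable_of_hasCompactSupport ?_ ?_
  · exact (contDiff_transport_apply hα hF (hs.trans (shell_subset_energySet _ _ _)) t).continuous.comp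
      (Continuous.prodMk_right y)
  · exact HasCompactSupport.intro isCompact_Icc fun v hv => transport_eq_zero hβ hs hv

/-- The spatial density of the transport of `F`. -/
noncomputable def density (F : TH2 → ℝ) (t : ℝ) (y : Coord) : ℝ :=
  (height y)⁻¹ * ∫ v : Coord, transport F t (y, v)

theorem spatialDensity_eq {f : ℝ → TH2 → ℝ} {t : ℝ} {F : TH2 → ℝ}
    (h : ∀ p, f t p = transport F t p) : spatialDensity f t = density F t := by
  ext y
  rw [spatialDensity, density, sqrt_det_gram, integral_mul_const, mul_comm]
  simp only [h]

theorem contDiff_density {α β L : ℝ} (hα : 0 < α) (hβ : 0 ≤ β) {F : TH2 → ℝ}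
    (hF : ContDiff ℝ 1 F) (hs : Function.support F ⊆ shell α β L) (t : ℝ) :
    ContDiff ℝ 1 (density F t) := by
  unfold density
  refine (contDiff_height.inv fun y => (height_pos y).ne').mul ?_
  rw [contDiff_iff_contDiffAt]
  intro y₀
  -- Over this neighbourhood all velocity supports lie in one compact box.
  set U : Set Coord := {y | height y < height y₀ + 1} with hU
  have hUo : IsOpen U := isOpen_lt (contDiff_height (n := 0)).continuous continuous_const
  set R : ℝ := (height y₀ + 1) * β with hR
  have hzero : ∀ y : Coord, ∀ v : Coord, y ∈ U →
      v ∉ Set.Icc (fun _ : Fin 2 => -R) (fun _ => R) → transport F t (y, -v) = 0 := by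
    intro y v hy hv
    refine transport_eq_zero hβ hs fun hmem => hv ?_
    have hyR : height y * β ≤ R := mul_le_mul_of_nonneg_right hy.le hβ
    constructor <;> intro i
    · have := hmem.2 i
      simp only [Pi.neg_apply] at this
      linarith
    · have := hmem.1 i
      simp only [Pi.neg_apply] at this
      linarith
  -- The fibre integral is the convolution, at the point 0, of the constant 1 with a function
  -- depending on the parameter y; the sign change of v it introduces is undone at the end.
  have hC := contDiffOn_convolution_right_with_param_comp (n := 1) (𝕜 := ℝ)
    (ContinuousLinearMap.mul ℝ ℝ) (s := U) (v := fun _ : Coord => (0 : Coord))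
    (μ := volume) (f := fun _ : Coord => (1 : ℝ)) (g := fun y v => transport F t (y, v))
    (k := Set.Icc (fun _ : Fin 2 => -R) (fun _ => R)) contDiffOn_const hUo isCompact_Icc
    (fun y v hy hv => by
      have := hzero y (-v) hy fun hmem => hv ⟨fun i => ?_, fun i => ?_⟩
      · simpa using this
      · have := hmem.2 i
        simp only [Pi.neg_apply] at this
        linarith
      · have := hmem.1 i
        simp only [Pi.neg_apply] at this
        linarith)
    (locallyIntegrable_const _)
    (contDiff_transport_apply hα hF (hs.trans (shell_subset_energySet _ _ _)) t).contDiffOn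
  refine (hC.contDiffAt (hUo.mem_nhds (by simp [hU]))).congr_of_eventuallyEq ?_
  refine Filter.Eventually.of_forall fun y => ?_
  simp only [convolution, ContinuousLinearMap.mul_apply', one_mul, zero_sub]
  exact (integral_neg_eq_self (fun v => transport F t (y, v)) volume).symm

/-- On fibres a boost is a linear map whose determinant is the ratio of the heights, exactly
compensating the factors 1/H. -/
theorem density_boostPoint {n : Coord} (hn : n 0 ^ 2 + n 1 ^ 2 = 1) (F : TH2 → ℝ) (t ε : ℝ)
    (y : Coord) : density F t (boostPoint n ε y) = density (F ∘ boost n ε) t y := by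
  -- The fibre map is the rank-one perturbation I + n kᵀ, so its determinant is 1 + k·n.
  set k : Fin 2 → ℝ := fun i => (Real.cosh ε - 1) * n i + Real.sinh ε * (y i / height y) with hk
  set A : Coord →ₗ[ℝ] Coord :=
    Matrix.toLin' !![1 + k 0 * n 0, k 1 * n 0; k 0 * n 1, 1 + k 1 * n 1] with hA
  have hH := height_pos y
  have hH' := height_pos (boostPoint n ε y)
  have hdet : LinearMap.det A = height (boostPoint n ε y) / height y := by
    rw [hA, LinearMap.det_toLin', Matrix.det_fin_two_of, height_boostPoint hn]
    simp only [hk]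
    field_simp
    linear_combination (height y ^ 2 * (Real.cosh ε - 1)) * hn
  have hdet0 : 0 < LinearMap.det A := by
    rw [hdet]
    positivity
  have hAv : ∀ v, (boostPoint n ε y, A v) = boost n ε (y, v) := by
    intro v
    refine Prod.ext rfl ?_
    ext i
    fin_cases i
    · simp [hA, hk, boost, boostVec, vheight, Matrix.mulVec, dotProduct, Fin.sum_univ_two]
      ring
    · simp [hA, hk, boost, boostVec, vheight, Matrix.mulVec, dotProduct, Fin.sum_univ_two]
      ring
  have hint : ∫ v, transport F t (boostPoint n ε y, A v)
      = (LinearMap.det A)⁻¹ * ∫ v, transport F t (boostPoint n ε y, v) := by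
    have h1 := Measure.map_linearMap_addHaar_eq_smul_addHaar volume hdet0.ne'
    have h2 := (A.equivOfDetNeZero hdet0.ne').toContinuousLinearEquiv.toHomeomorph.measurableEmbedding
    have h3 := h2.integral_map (μ := volume) fun v => transport F t (boostPoint n ε y, v)
    have h4 : ⇑(A.equivOfDetNeZero hdet0.ne').toContinuousLinearEquiv.toHomeomorph = ⇑A := rfl
    rw [h4, h1, integral_smul_measure, abs_of_pos (inv_pos.2 hdet0),
      ENNReal.toReal_ofReal (inv_pos.2 hdet0).le] at h3
    exact h3.symm
  have hcomm : ∀ v, transport F t (boostPoint n ε y, A v) = transport (F ∘ boost n ε) t (y, v) := by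
    intro v
    rw [hAv, transport, transport, Function.comp_apply, boost_geodesicFlow hn]
  simp only [hcomm] at hint
  rw [density, density, hint, hdet]
  field_simp

/-! ### Size bounds and the Sasaki gradient along boosts. -/

theorem norm_le_of_energy_le {β : ℝ} (hβ : 0 ≤ β) {y v : Coord} (h : energy (y, v) ≤ β ^ 2) :
    ‖v‖ ≤ height y * β := by
  have hH := height_pos y
  obtain ⟨h1, h2⟩ := mem_Icc_of_energy_le hβ h
  rw [pi_norm_le_iff_of_nonneg (by positivity)]
  exact fun i => abs_le.2 ⟨h1 i, h2 i⟩

theorem norm_le_height (y : Coord) : ‖y‖ ≤ height y := by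
  have h := height_sq y
  rw [pi_norm_le_iff_of_nonneg (height_pos y).le]
  intro i
  refine abs_le_of_sq_le_sq ?_ (height_pos y).le
  fin_cases i
  · simp only [Fin.zero_eta]
    linarith [sq_nonneg (y 1)]
  · simp only [Fin.mk_one]
    linarith [sq_nonneg (y 0)]

theorem abs_vheight_le {β : ℝ} (hβ : 0 ≤ β) {y v : Coord} (h : energy (y, v) ≤ β ^ 2) :
    |vheight y v| ≤ height y * β := by
  have hH := height_pos y
  have h1 := vheight_sq_le (y, v)
  have h2 := energy_nonneg (y, v)
  simp only at h1
  refine abs_le_of_sq_le_sq ?_ (by positivity)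
  have h3 : height y ^ 2 * energy (y, v) ≤ height y ^ 2 * β ^ 2 := by gcongr
  rw [mul_pow]
  linarith

theorem abs_metric_le {β γ : ℝ} (hβ : 0 ≤ β) (hγ : 0 ≤ γ) {y v a : Coord}
    (hv : energy (y, v) ≤ β ^ 2) (ha : energy (y, a) ≤ γ ^ 2) :
    |metric y v a| ≤ 3 * ((height y * β) * (height y * γ)) := by
  have hH := height_pos y
  have hvi := fun i => (norm_le_pi_norm v i).trans (norm_le_of_energy_le hβ hv)
  have hai := fun i => (norm_le_pi_norm a i).trans (norm_le_of_energy_le hγ ha)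
  simp only [Real.norm_eq_abs] at hvi hai
  have h0 : ∀ {x z : ℝ}, |x| ≤ height y * β → |z| ≤ height y * γ →
      |x * z| ≤ (height y * β) * (height y * γ) := by
    intro x z hx hz
    rw [abs_mul]
    exact mul_le_mul hx hz (abs_nonneg _) (by positivity)
  rw [metric_eq]
  have e1 := abs_le.1 (h0 (hvi 0) (hai 0))
  have e2 := abs_le.1 (h0 (hvi 1) (hai 1))
  have e3 := abs_le.1 (h0 (abs_vheight_le hβ hv) (abs_vheight_le hγ ha))
  rw [abs_le]
  constructor <;> linarith [e1.1, e1.2, e2.1, e2.2, e3.1, e3.2]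

theorem metric_self_nonneg (y a : Coord) : 0 ≤ metric y a a := energy_nonneg (y, a)

theorem metric_self_le (y a : Coord) : metric y a a ≤ a 0 ^ 2 + a 1 ^ 2 := by
  rw [metric_self_eq]
  linarith [sq_nonneg (vheight y a)]

theorem vheight_smul (y a : Coord) (c : ℝ) : vheight y (c • a) = c * vheight y a := by
  simp only [vheight, Pi.smul_apply, smul_eq_mul]
  ring

theorem metric_smul_smul (y a b : Coord) (c d : ℝ) :
    metric y (c • a) (d • b) = c * d * metric y a b := by
  simp only [metric_eq, vheight_smul, Pi.smul_apply, smul_eq_mul]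
  ring

theorem hor_smul_add_ver_smul (y v a b : Coord) (c : ℝ) :
    hor y v (c • a) + ver (c • b) = c • (hor y v a + ver b) := by
  have h := metric_smul_smul y v a 1 c
  rw [one_smul, one_mul] at h
  rw [hor_eq, hor_eq, h]
  refine Prod.ext ?_ ?_
  · simp [ver]
  · simp [ver, smul_smul]

section Gradient

variable {α β L : ℝ} {K : Set TH2} {F : TH2 → ℝ}

theorem fderiv_eq_zero_of_notMem (hK : IsCompact K) (hs : Function.support F ⊆ K) {p : TH2}
    (hp : p ∉ K) : fderiv ℝ F p = 0 :=
  fderiv_of_notMem_tsupport ℝ fun h => hp (closure_minimal hs hK.isClosed h)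

/-- Needed because the real `sSup` of an unbounded set is the default value 0. Off K the
differential vanishes; over K bounded heights bound the coordinate size of Sasaki-unit vectors. -/
theorem bddAbove_sasaki (hβ : 0 ≤ β) (hL : 0 ≤ L) (hK : IsCompact K) (hKs : K ⊆ shell α β L)
    (hF : ContDiff ℝ 1 F) (hs : Function.support F ⊆ K) :
    BddAbove {s | ∃ y v a b : Coord, metric y a a + metric y b b ≤ 1 ∧
      s = |fderiv ℝ F (y, v) (hor y v a + ver b)|} := by
  obtain ⟨D, hD⟩ := hK.exists_bound_of_continuousOn (hF.continuous_fderiv one_ne_zero).continuousOn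
  refine ⟨max D 0 * (L + (3 * ((L * β) * (L * 1)) * L + L)), ?_⟩
  rintro s ⟨y, v, a, b, hab, rfl⟩
  by_cases hp : (y, v) ∈ K
  · obtain ⟨-, hE, hH⟩ := hKs hp
    simp only at hH
    have hH0 := height_pos y
    have ha : energy (y, a) ≤ 1 ^ 2 := by
      rw [one_pow]
      exact le_trans (le_add_of_nonneg_right (metric_self_nonneg y b)) hab
    have hb : energy (y, b) ≤ 1 ^ 2 := by
      rw [one_pow]
      exact le_trans (le_add_of_nonneg_left (metric_self_nonneg y a)) hab
    have ha1 := norm_le_of_energy_le zero_le_one ha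
    have hb1 := norm_le_of_energy_le zero_le_one hb
    rw [mul_one] at ha1 hb1
    have hm : |metric y v a| ≤ 3 * ((L * β) * (L * 1)) :=
      (abs_metric_le hβ zero_le_one hE ha).trans (by gcongr)
    have hy := (norm_le_height y).trans hH
    have h1 : ‖hor y v a + ver b‖ ≤ L + (3 * ((L * β) * (L * 1)) * L + L) := by
      rw [hor_eq, ver, Prod.mk_add_mk, add_zero]
      have h2 : ‖metric y v a • y + b‖ ≤ 3 * ((L * β) * (L * 1)) * L + L := by
        refine (norm_add_le _ _).trans (add_le_add ?_ (hb1.trans hH))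
        rw [norm_smul]
        exact mul_le_mul hm hy (norm_nonneg _) (by positivity)
      refine (Prod.norm_mk _ _).le.trans (max_le ?_ ?_)
      · linarith [norm_nonneg (metric y v a • y + b)]
      · linarith
    rw [← Real.norm_eq_abs]
    refine (ContinuousLinearMap.le_opNorm _ _).trans ?_
    exact mul_le_mul ((hD _ hp).trans (le_max_left _ _)) h1 (norm_nonneg _) (le_max_right _ _)
  · rw [fderiv_eq_zero_of_notMem hK hs hp]
    simp only [zero_apply, abs_zero]
    positivity

theorem sasakiGradSup_nonneg (F : TH2 → ℝ) : 0 ≤ sasakiGradSup F := by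
  refine Real.sSup_nonneg ?_
  rintro s ⟨y, v, a, b, -, rfl⟩
  exact abs_nonneg _

theorem abs_fderiv_le_sasakiGradSup (hβ : 0 ≤ β) (hL : 0 ≤ L) (hK : IsCompact K)
    (hKs : K ⊆ shell α β L) (hF : ContDiff ℝ 1 F) (hs : Function.support F ⊆ K) {N : ℝ}
    (hN : 0 < N) {y v a b : Coord} (h : metric y a a + metric y b b ≤ N ^ 2) :
    |fderiv ℝ F (y, v) (hor y v a + ver b)| ≤ N * sasakiGradSup F := by
  have h1 : |fderiv ℝ F (y, v) (hor y v (N⁻¹ • a) + ver (N⁻¹ • b))| ≤ sasakiGradSup F := by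
    refine le_csSup (bddAbove_sasaki hβ hL hK hKs hF hs) ⟨y, v, N⁻¹ • a, N⁻¹ • b, ?_, rfl⟩
    rw [metric_smul_smul, metric_smul_smul, ← mul_add, ← mul_inv, ← sq, inv_mul_le_iff₀ (by positivity),
      mul_one]
    exact h
  rw [hor_smul_add_ver_smul, map_smul, smul_eq_mul, abs_mul, abs_of_pos (inv_pos.2 hN),
    inv_mul_le_iff₀ hN] at h1
  exact h1

/-- A bound on a shell for the Sasaki length of the generators of boosts. -/
noncomputable def boostBound (β L : ℝ) : ℝ := L + 2 * (L * β + 3 * ((L * β) * (L * L)) * L)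

theorem abs_fderiv_boost_le (hβ : 0 ≤ β) (hL : 0 < L) (hK : IsCompact K)
    (hKs : K ⊆ shell α β L) (hF : ContDiff ℝ 1 F) (hs : Function.support F ⊆ K) {n : Coord}
    (hn : n 0 ^ 2 + n 1 ^ 2 = 1) (p : TH2) :
    |fderiv ℝ F p (height p.1 • n, vheight p.1 p.2 • n)| ≤ boostBound β L * sasakiGradSup F := by
  have hB : 0 < boostBound β L := by
    unfold boostBound
    positivity
  by_cases hp : p ∈ K
  · obtain ⟨y, v⟩ := p
    obtain ⟨-, hE, hH⟩ := hKs hp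
    simp only at hH ⊢
    have hH0 := height_pos y
    set a := height y • n with ha
    -- The vertical part of the boost generator, left after removing the horizontal lift of `a`.
    set b := vheight y v • n - metric y v a • y with hb
    have e : (a, vheight y v • n) = hor y v a + ver b := by
      rw [hor_eq, ver, hb, Prod.mk_add_mk, add_zero, add_sub_cancel]
    rw [e]
    refine abs_fderiv_le_sasakiGradSup hβ hL.le hK hKs hF hs hB ?_
    have haa : metric y a a ≤ height y ^ 2 := by
      refine (metric_self_le y a).trans_eq ?_
      simp only [ha, Pi.smul_apply, smul_eq_mul]
      linear_combination height y ^ 2 * hn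
    have hm : |metric y v a| ≤ 3 * ((L * β) * (L * L)) :=
      (abs_metric_le hβ hH0.le hE haa).trans (by gcongr)
    have hV : |vheight y v| ≤ L * β := (abs_vheight_le hβ hE).trans (by gcongr)
    have hy := (norm_le_height y).trans hH
    have hni : ∀ i, |n i| ≤ 1 := by
      intro i
      refine abs_le_of_sq_le_sq ?_ zero_le_one
      fin_cases i
      · simp only [Fin.zero_eta]
        linarith [sq_nonneg (n 1)]
      · simp only [Fin.mk_one]
        linarith [sq_nonneg (n 0)]
    have hbi : ∀ i, b i ^ 2 ≤ (L * β + 3 * ((L * β) * (L * L)) * L) ^ 2 := by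
      intro i
      refine sq_le_sq' ?_ ?_ <;> rw [hb, Pi.sub_apply, Pi.smul_apply, Pi.smul_apply, smul_eq_mul,
        smul_eq_mul]
      all_goals
        have h1 : |vheight y v * n i| ≤ L * β * 1 := by
          rw [abs_mul]
          exact mul_le_mul hV (hni i) (abs_nonneg _) (by positivity)
        have h2 : |metric y v a * y i| ≤ 3 * ((L * β) * (L * L)) * L := by
          rw [abs_mul]
          exact mul_le_mul hm ((norm_le_pi_norm y i).trans hy) (abs_nonneg _) (by positivity)
        rw [abs_le] at h1 h2
        linarith [h1.1, h1.2, h2.1, h2.2]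
    have hbb := metric_self_le y b
    have hL2 : height y ^ 2 ≤ L ^ 2 := by gcongr
    have hc : 0 ≤ L * β + 3 * ((L * β) * (L * L)) * L := by positivity
    unfold boostBound
    generalize L * β + 3 * ((L * β) * (L * L)) * L = c at hbi hc
    nlinarith [hbi 0, hbi 1, mul_nonneg hL.le hc, sq_nonneg c]
  · rw [fderiv_eq_zero_of_notMem hK hs hp]
    simp only [zero_apply, abs_zero]
    exact mul_nonneg hB.le (sasakiGradSup_nonneg F)

theorem boost_zero (n : Coord) (p : TH2) : boost n 0 p = p := by
  simp [boost, boostPoint, boostVec]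

/-! ### Decay of the density and of its derivatives. -/

theorem abs_comp_boost_sub_le (hβ : 0 ≤ β) (hL : 0 < L) (hK : IsCompact K)
    (hKs : K ⊆ shell α β L) (hF : ContDiff ℝ 1 F) (hs : Function.support F ⊆ K) {n : Coord}
    (hn : n 0 ^ 2 + n 1 ^ 2 = 1) (ε : ℝ) (p : TH2) :
    |F (boost n ε p) - F p| ≤ boostBound β L * sasakiGradSup F * |ε| := by
  have hd : ∀ s, HasDerivAt (fun s => F (boost n s p)) (fderiv ℝ F (boost n s p)
      (height (boost n s p).1 • n, vheight (boost n s p).1 (boost n s p).2 • n)) s := fun s =>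
    ((hF.differentiable one_ne_zero) _).hasFDerivAt.comp_hasDerivAt s (hasDerivAt_boost hn s p)
  have h := convex_univ.norm_image_sub_le_of_norm_hasDerivWithin_le
    (fun s _ => (hd s).hasDerivWithinAt)
    (fun s _ => abs_fderiv_boost_le hβ hL hK hKs hF hs hn (boost n s p))
    (Set.mem_univ 0) (Set.mem_univ ε)
  simpa only [boost_zero, sub_zero, Real.norm_eq_abs] using h

theorem abs_density_le (hα : 0 < α) (hβ : 0 ≤ β) (hL : 0 ≤ L) {t : ℝ} (ht : 0 ≤ t)
    (hF : Function.support F ⊆ shell α β L) {M : ℝ} (hM : ∀ p, |F p| ≤ M) (y : Coord) :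
    |density F t y| ≤ 16 * L * β ^ 2 * Real.exp (-(α * t)) * M := by
  have hH := height_pos y
  rw [density, abs_mul, abs_of_pos (inv_pos.2 hH), inv_mul_le_iff₀ hH]
  refine (abs_integral_transport_le hα hβ hL ht hF hM y).trans_eq ?_
  ring

theorem support_comp_boost_subset (hs : Function.support F ⊆ shell α β L) {n : Coord}
    (hn : n 0 ^ 2 + n 1 ^ 2 = 1) {ε : ℝ} (hε : |ε| ≤ 1) :
    Function.support (F ∘ boost n ε) ⊆ shell α β (3 * L) := by
  intro p hp
  obtain ⟨h1, h2, h3⟩ := hs (show boost n ε p ∈ Function.support F from hp)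
  rw [energy_boost hn] at h1 h2
  refine ⟨h1, h2, (height_le_three_mul_height_boostPoint hn hε p.1).trans ?_⟩
  exact mul_le_mul_of_nonneg_left h3 (by norm_num)

theorem shell_mono (hL : 0 ≤ L) : shell α β L ⊆ shell α β (3 * L) :=
  fun _ hp => ⟨hp.1, hp.2.1, hp.2.2.trans (by linarith)⟩

/-- The difference is the density of F ∘ boost - F, which is O(ε) in sup norm and supported in the
shell with 3L in place of L. No differentiation under the integral is needed. -/
theorem abs_density_boostPoint_sub_le (hα : 0 < α) (hβ : 0 ≤ β) (hL : 0 < L) (hK : IsCompact K)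
    (hKs : K ⊆ shell α β L) (hF : ContDiff ℝ 1 F) (hs : Function.support F ⊆ K) {n : Coord}
    (hn : n 0 ^ 2 + n 1 ^ 2 = 1) {t : ℝ} (ht : 0 ≤ t) {ε : ℝ} (hε : |ε| ≤ 1) (y : Coord) :
    |density F t (boostPoint n ε y) - density F t y| ≤
      16 * (3 * L) * β ^ 2 * Real.exp (-(α * t)) * (boostBound β L * sasakiGradSup F * |ε|) := by
  have hs1 := support_comp_boost_subset (hs.trans hKs) hn hε
  have hs2 := (hs.trans hKs).trans (shell_mono hL.le)
  have hsub : density (F ∘ boost n ε) t y - density F t y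
      = density (fun p => F (boost n ε p) - F p) t y := by
    rw [density, density, density, ← mul_sub, ← integral_sub
      (integrable_transport hα hβ (hF.comp (contDiff_boost n ε)) hs1 t y)
      (integrable_transport hα hβ hF hs2 t y)]
    rfl
  rw [density_boostPoint hn, hsub]
  refine abs_density_le hα hβ (by positivity) ht ?_
    (abs_comp_boost_sub_le hβ hL hK hKs hF hs hn ε) y
  refine (Function.support_sub (F ∘ boost n ε) F).trans ?_
  exact Set.union_subset hs1 hs2

/-- A constant for the decay of the derivatives of the density. -/
noncomputable def gradConst (β L : ℝ) : ℝ := 16 * (3 * L) * β ^ 2 * boostBound β L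

theorem abs_fderiv_density_smul_le (hα : 0 < α) (hβ : 0 ≤ β) (hL : 0 < L) (hK : IsCompact K)
    (hKs : K ⊆ shell α β L) (hF : ContDiff ℝ 1 F) (hs : Function.support F ⊆ K) {n : Coord}
    (hn : n 0 ^ 2 + n 1 ^ 2 = 1) {t : ℝ} (ht : 0 ≤ t) (y : Coord) :
    |fderiv ℝ (density F t) y (height y • n)| ≤
      gradConst β L * Real.exp (-(α * t)) * sasakiGradSup F := by
  have hS := sasakiGradSup_nonneg F
  have hB : 0 ≤ boostBound β L := by
    unfold boostBound
    positivity
  have h0 : boostPoint n 0 y = y := congrArg Prod.fst (boost_zero n (y, 0))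
  have h1 : HasDerivAt (fun ε => boostPoint n ε y) (height y • n) 0 := by
    have h := (ContinuousLinearMap.fst ℝ Coord Coord).hasFDerivAt.comp_hasDerivAt 0
      (hasDerivAt_boost hn 0 (y, 0))
    rw [boost_zero] at h
    exact h
  have h2 : HasDerivAt (fun ε => density F t (boostPoint n ε y))
      (fderiv ℝ (density F t) y (height y • n)) 0 := by
    have hd := ((contDiff_density hα hβ hF (hs.trans hKs) t).differentiable one_ne_zero
      (boostPoint n 0 y)).hasFDerivAt.comp_hasDerivAt 0 h1
    rwa [h0] at hd
  unfold gradConst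
  refine h2.le_of_lip' (by positivity) ?_
  filter_upwards [Metric.ball_mem_nhds (0 : ℝ) one_pos] with ε hε
  rw [mem_ball_zero_iff, Real.norm_eq_abs] at hε
  simp only [h0, sub_zero, Real.norm_eq_abs]
  refine (abs_density_boostPoint_sub_le hα hβ hL hK hKs hF hs hn ht hε.le y).trans_eq ?_
  ring

theorem fderiv_density_eq_zero (hα : 0 < α) {t : ℝ} (ht : 0 ≤ t)
    (hs : Function.support F ⊆ shell α β L) {y : Coord}
    (hy : 4 * L * height y < Real.exp (α * t)) : fderiv ℝ (density F t) y = 0 := by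
  have h1 : ∀ᶠ z in nhds y, 4 * L * height z < Real.exp (α * t) :=
    ((contDiff_height (n := 0)).continuous.const_mul (4 * L)).continuousAt.eventually_lt_const hy
  have h2 : density F t =ᶠ[nhds y] fun _ => 0 := by
    filter_upwards [h1] with z hz
    have h3 : ∀ v, transport F t (z, v) = 0 := by
      intro v
      by_contra hne
      exact absurd (exp_le_height_of_mem_shell hα ht (hs hne)) (not_le.2 hz)
    simp [density, h3]
  rw [h2.fderiv_eq]
  exact fderiv_const_apply 0

/-- Either the density vanishes near y, or H ≥ e^{αt}/(4L) and dividing the bound for H n by H gains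
another e^{-αt}. -/
theorem abs_fderiv_density_le (hα : 0 < α) (hβ : 0 ≤ β) (hL : 0 < L) (hK : IsCompact K)
    (hKs : K ⊆ shell α β L) (hF : ContDiff ℝ 1 F) (hs : Function.support F ⊆ K) {n : Coord}
    (hn : n 0 ^ 2 + n 1 ^ 2 = 1) {t : ℝ} (ht : 0 ≤ t) (y : Coord) :
    |fderiv ℝ (density F t) y n| ≤
      4 * L * gradConst β L * Real.exp (-(2 * α * t)) * sasakiGradSup F := by
  have hS := sasakiGradSup_nonneg F
  have h := abs_fderiv_density_smul_le hα hβ hL hK hKs hF hs hn ht y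
  have hG : 0 ≤ gradConst β L := by
    unfold gradConst boostBound
    positivity
  rcases lt_or_ge (4 * L * height y) (Real.exp (α * t)) with hy | hy
  · rw [fderiv_density_eq_zero hα ht (hs.trans hKs) hy]
    simp only [zero_apply, abs_zero]
    positivity
  · rw [map_smul, smul_eq_mul, abs_mul, abs_of_pos (height_pos y)] at h
    have h1 : Real.exp (α * t) * |fderiv ℝ (density F t) y n| ≤
        4 * L * (gradConst β L * Real.exp (-(α * t)) * sasakiGradSup F) :=
      calc _ ≤ 4 * L * height y * |fderiv ℝ (density F t) y n| := by gcongr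
        _ = 4 * L * (height y * |fderiv ℝ (density F t) y n|) := by ring
        _ ≤ _ := by gcongr
    have h2 : Real.exp (-(2 * α * t)) = Real.exp (-(α * t)) * Real.exp (-(α * t)) := by
      rw [← Real.exp_add]
      ring_nf
    have h3 : |fderiv ℝ (density F t) y n| =
        Real.exp (-(α * t)) * (Real.exp (α * t) * |fderiv ℝ (density F t) y n|) := by
      rw [← mul_assoc, ← Real.exp_add, neg_add_cancel, Real.exp_zero, one_mul]
    rw [h3, h2]
    refine (mul_le_mul_of_nonneg_left h1 (Real.exp_pos _).le).trans_eq ?_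
    ring

end Gradient

/-! ### Norms, polar coordinates and the conclusion. -/

theorem abs_le_supNorm {F : TH2 → ℝ} {K : Set TH2} (hF : Continuous F) (hK : IsCompact K)
    (hs : Function.support F ⊆ K) (p : TH2) : |F p| ≤ supNorm F := by
  refine le_ciSup (f := fun p => |F p|) ?_ p
  refine hF.abs.bddAbove_range_of_hasCompactSupport ?_
  exact HasCompactSupport.intro hK fun q hq => by
    rw [abs_eq_zero]
    by_contra hne
    exact hq (hs hne)

theorem supNorm_nonneg (F : TH2 → ℝ) : 0 ≤ supNorm F := Real.iSup_nonneg fun _ => abs_nonneg _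

theorem height_polar (r θ : ℝ) : height (polar r θ) = Real.cosh r := by
  have h := congrFun (param_polar r θ) 0
  exact h

theorem hasDerivAt_polar_radius (r θ : ℝ) : HasDerivAt (fun s => polar s θ)
    (height (polar r θ) • ![Real.cos θ, Real.sin θ]) r := by
  rw [hasDerivAt_pi, height_polar]
  intro i
  fin_cases i
  · exact (Real.hasDerivAt_sinh r).mul_const _
  · exact (Real.hasDerivAt_sinh r).mul_const _

theorem hasDerivAt_polar_angle (r θ : ℝ) : HasDerivAt (fun φ => polar r φ)
    (Real.sinh r • ![-Real.sin θ, Real.cos θ]) θ := by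
  rw [hasDerivAt_pi]
  intro i
  fin_cases i
  · exact (Real.hasDerivAt_cos θ).const_mul _
  · exact (Real.hasDerivAt_sin θ).const_mul _

theorem exists_subset_shell {α : ℝ} {K : Set TH2} (hK : IsCompact K) (hKα : K ⊆ energySet α) :
    ∃ β L : ℝ, 0 ≤ β ∧ 0 < L ∧ K ⊆ shell α β L := by
  obtain ⟨B, hB⟩ := hK.exists_bound_of_continuousOn
    (contDiff_energy (n := 0)).continuous.continuousOn
  obtain ⟨L, hL⟩ := hK.exists_bound_of_continuousOn
    ((contDiff_height (n := 0)).continuous.comp continuous_fst).continuousOn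
  refine ⟨√|B|, |L| + 1, Real.sqrt_nonneg _, by positivity, fun p hp => ⟨hKα hp, ?_, ?_⟩⟩
  · rw [Real.sq_sqrt (abs_nonneg B)]
    exact (le_abs_self _).trans ((hB p hp).trans (le_abs_self B))
  · have := (le_abs_self _).trans ((hL p hp).trans (le_abs_self L))
    simp only [Function.comp_apply] at this
    linarith

end HypVlasov

theorem mainTheorem1 (α : ℝ) (hα : 0 < α) (K : Set HypVlasov.TH2) (hK : IsCompact K)
    (hKα : K ⊆ HypVlasov.energySet α) :
    ∃ C : ℝ, 0 < C ∧
      ∀ f₀ : HypVlasov.TH2 → ℝ, ContDiff ℝ 1 f₀ → Function.support f₀ ⊆ K →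
        (∃ f : ℝ → HypVlasov.TH2 → ℝ, HypVlasov.IsVlasovField f ∧ f 0 = f₀) ∧
        ∀ f : ℝ → HypVlasov.TH2 → ℝ, HypVlasov.IsVlasovField f → f 0 = f₀ →
          ∀ t : ℝ, 0 ≤ t →
            (∀ y : HypVlasov.Coord, Integrable (fun v : HypVlasov.Coord => f t (y, v))) ∧
            ContDiff ℝ 1 (HypVlasov.spatialDensity f t) ∧
            (∀ y : HypVlasov.Coord,
              |HypVlasov.spatialDensity f t y| ≤
                C * Real.exp (-(α * t)) * HypVlasov.supNorm f₀) ∧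
            (∀ r θ : ℝ, 0 < r →
              |(Real.sinh r)⁻¹ *
                  deriv (fun φ => HypVlasov.spatialDensity f t (HypVlasov.polar r φ)) θ| ≤
                C * Real.exp (-(2 * α * t)) * HypVlasov.sobolevNorm f₀) ∧
            (∀ r θ : ℝ, 0 < r →
              |deriv (fun s => HypVlasov.spatialDensity f t (HypVlasov.polar s θ)) r| ≤
                C * Real.exp (-(α * t)) * HypVlasov.sobolevNorm f₀) := by
  open HypVlasov in
  obtain ⟨β, L, hβ, hL, hKs⟩ := exists_subset_shell hK hKα
  have hG : 0 ≤ gradConst β L := by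
    unfold gradConst boostBound
    positivity
  have hA : 0 ≤ 16 * L * β ^ 2 := by positivity
  have hLG : 0 ≤ 4 * L * gradConst β L := by positivity
  -- One summand for each of the three estimates; the 1 keeps the constant positive if β = 0.
  refine ⟨16 * L * β ^ 2 + gradConst β L + 4 * L * gradConst β L + 1, by positivity, ?_⟩
  intro f₀ hf₀ hs
  refine ⟨⟨transport f₀, isVlasovField_transport hα hf₀ (hs.trans hKα), ?_⟩, ?_⟩
  · ext p
    simp [transport]
  rintro f hf rfl t ht
  have hft := fun p => hf.eq_transport ht p
  have hsh := hs.trans hKs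
  have hρ := contDiff_density hα hβ hf₀ hsh t
  have hS := sasakiGradSup_nonneg (f 0)
  have hN := supNorm_nonneg (f 0)
  have hW : sasakiGradSup (f 0) ≤ sobolevNorm (f 0) := by
    unfold sobolevNorm
    linarith
  rw [spatialDensity_eq hft]
  refine ⟨fun y => ?_, hρ, fun y => ?_, fun r θ hr => ?_, fun r θ _ => ?_⟩
  · simp only [hft]
    exact integrable_transport hα hβ hf₀ hsh t y
  · refine (abs_density_le hα hβ hL.le ht hsh (abs_le_supNorm hf₀.continuous hK hs) y).trans ?_
    gcongr
    linarith
  · have hn : (![-Real.sin θ, Real.cos θ] : Coord) 0 ^ 2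
        + (![-Real.sin θ, Real.cos θ] : Coord) 1 ^ 2 = 1 := by simp
    have hd := (hρ.differentiable one_ne_zero (polar r θ)).hasFDerivAt.comp_hasDerivAt θ
      (hasDerivAt_polar_angle r θ)
    have hr' : Real.sinh r ≠ 0 := (Real.sinh_pos_iff.2 hr).ne'
    have he : (Real.sinh r)⁻¹ * deriv (fun φ => density (f 0) t (polar r φ)) θ
        = fderiv ℝ (density (f 0) t) (polar r θ) ![-Real.sin θ, Real.cos θ] := by
      rw [HasDerivAt.deriv (f := fun φ => density (f 0) t (polar r φ)) hd, map_smul, smul_eq_mul,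
        inv_mul_cancel_left₀ hr']
    rw [he]
    refine (abs_fderiv_density_le hα hβ hL hK hKs hf₀ hs hn ht _).trans ?_
    gcongr
    linarith
  · have hn : (![Real.cos θ, Real.sin θ] : Coord) 0 ^ 2
        + (![Real.cos θ, Real.sin θ] : Coord) 1 ^ 2 = 1 := by simp
    have hd := (hρ.differentiable one_ne_zero (polar r θ)).hasFDerivAt.comp_hasDerivAt r
      (hasDerivAt_polar_radius r θ)
    rw [HasDerivAt.deriv (f := fun s => density (f 0) t (polar s θ)) hd]
    refine (abs_fderiv_density_smul_le hα hβ hL hK hKs hf₀ hs hn ht _).trans ?_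
    gcongr
    linarith
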